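/- **Setting.** For $\alpha,\beta\ge 0$ let $h=-\Delta\otimes 1+\alpha\,\overline{(D^-\otimes S^+-D^+\otimes S^-)}+2\beta\,(1\otimes S^3)$ be the self-adjoint Rashba operator in $L^2(\mathbb R^3)\otimes\mathbb C^2$ with domain $H^2(\mathbb R^3)\otimes\mathbb C^2$, where $D^\pm=\nabla_1\pm i\nabla_2$, $S^i=\tfrac12\sigma^i$ with the Pauli matrices $\sigma^i$, and $S^\pm=S^1\pm iS^2$. Let $H=h\otimes 1+1\otimes h$ be the two-particle operator and $R(z)=(H-z)^{-1}$. Write $q=(x_1,x_2)\in\mathbb R^6$ and $Q=Kq=(x,X)$ with $x=x_1-x_2$, $X=\tfrac12(x_1+x_2)$, and let $(\mathcal Uf)(q)=f(Kq)$ on $L^2(\mathbb R^6)$. Let $|\sigma\rangle=|Ss\rangle$, with $S\in\{0,1\}$ and $s\in\{-S,\dots,S\}$, be the coupled-spin basis of $\mathbb C^2\otimes\mathbb C^2\cong\mathbb C^3\oplus\mathbb C^1$ given by the Clebsch–Gordan coefficients of $SU(2)$, and let $L$ be the unitary map $$L\colon (u\otimes|s_1\rangle)\otimes(v\otimes|s_2\rangle)\mapsto\sum_{S,s}\begin{bmatrix}\tfrac12&\tfrac12&S\\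 s_1&s_2&s\end{bmatrix}\,u(x)v(X)\otimes|Ss\rangle ,$$ where $u(x)v(X)$ denotes $\mathcal U(u\otimes v)$, that is, the function $q\mapsto u(x_1-x_2)\,v(\tfrac12(x_1+x_2))$. Put $R^c(z)=LR(z)L^*$. The Green function $(R^c_{\sigma'\sigma}(z))_{\sigma',\sigma}$ is the family of locally integrable functions on $\mathbb R^6$ such that, for all $f\in L^2(\mathbb R^6)$ and all $\sigma$, $$R^c(z)\bigl(f(Q)\otimes|\sigma\rangle\bigr)=\sum_{\sigma'}\mathop{\mathrm{l.i.m.}}_{r\to\infty}\int_{|Q'|\le r}R^c_{\sigma'\sigma}(z)(Q-Q')\,f(Q')\,dQ'\otimes|\sigma'\rangle ,\qquad Q=Kq,$$ where l.i.m. is the limit in $L^2(\mathbb R^6)$ and a function of $Q=Kq$ is read as a function of $q$ (so $f(Q)$ stands for $\mathcal Uf$). Further, $|Q|^2=Q^2=|x|^2+|X|^2$, $\sqrt{\cdot}$ is the principal square root, and $K_\nu(w)=\int_0^\infty e^{-w\cosh t}\cosh(\nu t)\,dt$ ($\operatorname{Re}w>0$) is the Macdonald function. **Proposition.** Let $\alpha=0$,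 $\beta\ge0$ and $\operatorname{Im}z\ne0$. Then $R(z)$ exists as a bounded operator, the Green function exists and is unique up to null sets, and for all $\sigma'$, all $\sigma=(S,s)$ and a.e. $Q\in\mathbb R^6$ $$R^c_{\sigma'\sigma}(z)(Q)=-\frac{\delta_{\sigma'\sigma}}{8\pi^3Q^2}\Bigl(\delta_{s0}\,zK_2(|Q|\sqrt{-z})+\delta_{S1}\bigl[\delta_{s1}(z-2\beta)K_2(|Q|\sqrt{2\beta-z})+\delta_{s,-1}(z+2\beta)K_2(|Q|\sqrt{-2\beta-z})\bigr]\Bigr).$$ If in addition $\beta=0$, then for all $\sigma',\sigma$ and a.e. $Q\in\mathbb R^6$ $$R^c_{\sigma'\sigma}(z)(Q)=-\delta_{\sigma'\sigma}\,\frac{zK_2(|Q|\sqrt{-z})}{8\pi^3Q^2}.$$ -/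

import Mathlib

namespace Rashba

noncomputable section

open MeasureTheory Filter Topology Complex
open scoped ENNReal SchwartzMap LineDeriv Laplacian

/-! ### The single-particle Hilbert space and the spin operators -/

/-- Position space `ℝ³`. -/
abbrev R3 := EuclideanSpace ℝ (Fin 3)

/-- `L²(ℝ³)`. -/
abbrev L2R3 := Lp ℂ 2 (volume : Measure R3)

/-- Spin labels: `0` stands for `s = 1/2` and `1` stands for `s = -1/2`. -/
abbrev Spin := Fin 2

/-- The Hilbert space `L²(ℝ³) ⊗ ℂ²`, written in components with respect to the standard basis
`|1/2⟩ = (1,0)`, `|-1/2⟩ = (0,1)` of `ℂ²`. -/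
abbrev OneParticle := PiLp 2 (fun _ : Spin => L2R3)

/-- The Pauli matrices. -/
def pauli : Fin 3 → Matrix Spin Spin ℂ :=
  ![!![0, 1; 1, 0], !![0, -I; I, 0], !![1, 0; 0, -1]]

/-- The spin operators `S^1, S^2, S^3`. -/
def spinOp (i : Fin 3) : Matrix Spin Spin ℂ := (1 / 2 : ℂ) • pauli i

/-- `S⁺ = S^1 + i S^2`. -/
def spinUp : Matrix Spin Spin ℂ := spinOp 0 + I • spinOp 1

/-- `S⁻ = S^1 - i S^2`. -/
def spinDown : Matrix Spin Spin ℂ := spinOp 0 - I • spinOp 1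

/-! ### The single-particle Rashba operator -/

/-- An `L²` function regarded as a tempered distribution. -/
def toDistr (u : L2R3) : 𝓢'(R3, ℂ) := (u : 𝓢'(R3, ℂ))

/-- The partial derivative `∇ᵢ` in the sense of distributions. -/
def pd (i : Fin 3) (T : 𝓢'(R3, ℂ)) : 𝓢'(R3, ℂ) :=
  ∂_{(EuclideanSpace.single i 1 : R3)} T

/-- `D⁺ = ∇₁ + i ∇₂`. -/
def Dplus (T : 𝓢'(R3, ℂ)) : 𝓢'(R3, ℂ) := pd 0 T + I • pd 1 T

/-- `D⁻ = ∇₁ - i ∇₂`. -/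
def Dminus (T : 𝓢'(R3, ℂ)) : 𝓢'(R3, ℂ) := pd 0 T - I • pd 1 T

/-- Component `s` of the differential expression
`-Δ ⊗ 1 + α (D⁻ ⊗ S⁺ - D⁺ ⊗ S⁻) + β (2 · 1 ⊗ S³)` applied to `u`. -/
def rashbaExpr (α β : ℝ) (u : OneParticle) (s : Spin) : 𝓢'(R3, ℂ) :=
  - Δ (toDistr (u s))
    + (α : ℂ) • ∑ s', (spinUp s s' • Dminus (toDistr (u s'))
        - spinDown s s' • Dplus (toDistr (u s')))
    + (β : ℂ) • ∑ s', (2 * spinOp 2 s s') • toDistr (u s')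

theorem toDistr_zero : toDistr 0 = 0 :=
  (Lp.toTemperedDistributionCLM ℂ (volume : Measure R3) 2).map_zero

theorem toDistr_add (u v : L2R3) : toDistr (u + v) = toDistr u + toDistr v :=
  (Lp.toTemperedDistributionCLM ℂ (volume : Measure R3) 2).map_add u v

theorem toDistr_smul (c : ℂ) (u : L2R3) : toDistr (c • u) = c • toDistr u :=
  (Lp.toTemperedDistributionCLM ℂ (volume : Measure R3) 2).map_smul c u

theorem rashbaExpr_zero (α β : ℝ) (s : Spin) : rashbaExpr α β 0 s = 0 := by
  have h := (LineDeriv.laplacianCLM ℂ R3 𝓢'(R3, ℂ)).map_zero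
  have hp : ∀ i, pd i 0 = 0 := fun i =>
    (LineDeriv.lineDerivOpCLM ℂ 𝓢'(R3, ℂ) (EuclideanSpace.single i 1 : R3)).map_zero
  rw [TemperedDistribution.laplacianCLM_apply] at h
  simp only [rashbaExpr, Dplus, Dminus, PiLp.zero_apply, toDistr_zero, h, hp, Fin.sum_univ_two]
  module

theorem rashbaExpr_add (α β : ℝ) (u v : OneParticle) (s : Spin) :
    rashbaExpr α β (u + v) s = rashbaExpr α β u s + rashbaExpr α β v s := by
  have h := fun a b => (LineDeriv.laplacianCLM ℂ R3 𝓢'(R3, ℂ)).map_add a b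
  have hp : ∀ i a b, pd i (a + b) = pd i a + pd i b := fun i a b =>
    (LineDeriv.lineDerivOpCLM ℂ 𝓢'(R3, ℂ) (EuclideanSpace.single i 1 : R3)).map_add a b
  simp only [TemperedDistribution.laplacianCLM_apply] at h
  simp only [rashbaExpr, Dplus, Dminus, PiLp.add_apply, toDistr_add, h, hp, Fin.sum_univ_two]
  module

theorem rashbaExpr_smul (α β : ℝ) (c : ℂ) (u : OneParticle) (s : Spin) :
    rashbaExpr α β (c • u) s = c • rashbaExpr α β u s := by
  have h := fun a => (LineDeriv.laplacianCLM ℂ R3 𝓢'(R3, ℂ)).map_smul c a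
  have hp : ∀ i a, pd i (c • a) = c • pd i a := fun i a =>
    (LineDeriv.lineDerivOpCLM ℂ 𝓢'(R3, ℂ) (EuclideanSpace.single i 1 : R3)).map_smul c a
  simp only [TemperedDistribution.laplacianCLM_apply] at h
  simp only [rashbaExpr, Dplus, Dminus, PiLp.smul_apply, toDistr_smul, h, hp, Fin.sum_univ_two]
  module

/-- The graph of the Rashba operator: pairs `(u, w)` with `u ∈ H²(ℝ³) ⊗ ℂ²` and `w` the `L²`
function representing the differential expression applied to `u`. -/
def rashbaGraph (α β : ℝ) : Submodule ℂ (OneParticle × OneParticle) where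
  carrier := {p | (∀ s, TemperedDistribution.MemSobolev 2 2 (toDistr (p.1 s))) ∧
    ∀ s, toDistr (p.2 s) = rashbaExpr α β p.1 s}
  zero_mem' := by
    refine ⟨fun s => ?_, fun s => ?_⟩
    · change TemperedDistribution.MemSobolev 2 2 (toDistr 0)
      rw [toDistr_zero]
      exact TemperedDistribution.memSobolev_fun_zero ..
    · change toDistr 0 = rashbaExpr α β 0 s
      rw [toDistr_zero, rashbaExpr_zero]
  add_mem' := by
    rintro a b ⟨ha, ha'⟩ ⟨hb, hb'⟩
    refine ⟨fun s => ?_, fun s => ?_⟩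
    · change TemperedDistribution.MemSobolev 2 2 (toDistr (a.1 s + b.1 s))
      rw [toDistr_add]
      exact (ha s).add (hb s)
    · change toDistr (a.2 s + b.2 s) = rashbaExpr α β (a.1 + b.1) s
      rw [toDistr_add, rashbaExpr_add, ha', hb']
  smul_mem' := by
    rintro c a ⟨ha, ha'⟩
    refine ⟨fun s => ?_, fun s => ?_⟩
    · change TemperedDistribution.MemSobolev 2 2 (toDistr (c • a.1 s))
      rw [toDistr_smul]
      exact (ha s).smul c
    · change toDistr (c • a.2 s) = rashbaExpr α β (c • a.1) s
      rw [toDistr_smul, rashbaExpr_smul, ha']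

/-- The Rashba spin-orbit coupled operator `h = h⁰ + α Uˢᵒ + β Uᴮ` in `L²(ℝ³) ⊗ ℂ²` with domain
`dom h = dom h⁰ = H²(ℝ³) ⊗ ℂ²`. -/
def rashba (α β : ℝ) : OneParticle →ₗ.[ℂ] OneParticle := (rashbaGraph α β).toLinearPMap

/-! ### The two-particle operator -/

/-- `ℝ⁶ = ℝ³ × ℝ³` with its Euclidean norm. -/
abbrev R6 := WithLp 2 (R3 × R3)

/-- `L²(ℝ⁶)`. -/
abbrev L2R6 := Lp ℂ 2 (volume : Measure R6)

/-- The Hilbert tensor product `(L²(ℝ³) ⊗ ℂ²) ⊗ (L²(ℝ³) ⊗ ℂ²)`, realised as `L²(ℝ⁶)`-valued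
families indexed by the spins `(s₁, s₂)`. -/
abbrev TwoParticle := PiLp 2 (fun _ : Spin × Spin => L2R6)

theorem memLp_tensor (u v : L2R3) :
    MemLp (fun q : R6 => u q.fst * v q.snd) 2 (volume : Measure R6) := by
  have hu := (memLp_two_iff_integrable_sq_norm (Lp.aestronglyMeasurable u)).1 (Lp.memLp u)
  have hv := (memLp_two_iff_integrable_sq_norm (Lp.aestronglyMeasurable v)).1 (Lp.memLp v)
  have hm : AEStronglyMeasurable (fun p : R3 × R3 => u p.1 * v p.2)
      ((volume : Measure R3).prod volume) :=
    (Lp.aestronglyMeasurable u).comp_fst.mul (Lp.aestronglyMeasurable v).comp_snd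
  have h : MemLp (fun p : R3 × R3 => u p.1 * v p.2) 2 ((volume : Measure R3).prod volume) := by
    rw [memLp_two_iff_integrable_sq_norm hm]
    simpa [mul_pow] using hu.mul_prod hv
  exact h.comp_measurePreserving (WithLp.volume_preserving_ofLp (U := R3) (V := R3))

/-- The elementary tensor `u ⊗ v`, `(x₁, x₂) ↦ u(x₁) v(x₂)`. -/
def tensorFun (u v : L2R3) : L2R6 := (memLp_tensor u v).toLp

/-- The elementary tensor of two single-particle vectors. -/
def tensorVec (u v : OneParticle) : TwoParticle :=
  WithLp.toLp 2 (fun s => tensorFun (u s.1) (v s.2))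

/-- The operator `A ⊙ B` on the span of the elementary tensors `u ⊗ v`, `u ∈ dom A`, `v ∈ dom B`:
`(A ⊙ B)(u ⊗ v) = A u ⊗ B v`. -/
def algTensorOp (A B : OneParticle →ₗ.[ℂ] OneParticle) : TwoParticle →ₗ.[ℂ] TwoParticle :=
  (Submodule.span ℂ
    {p | ∃ (u : A.domain) (v : B.domain),
      p = (tensorVec u.1 v.1, tensorVec (A u) (B v))}).toLinearPMap

/-- The operator `A ⊗ B`, the closure of `A ⊙ B`. -/
def tensorOp (A B : OneParticle →ₗ.[ℂ] OneParticle) : TwoParticle →ₗ.[ℂ] TwoParticle :=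
  (algTensorOp A B).closure

/-- The identity operator on the single-particle space. -/
def oneOp : OneParticle →ₗ.[ℂ] OneParticle :=
  (LinearMap.id : OneParticle →ₗ[ℂ] OneParticle).toPMap ⊤

/-- The two-particle operator `H = h ⊗ 1 + 1 ⊗ h` (operator sum). -/
def twoParticleOp (α β : ℝ) : TwoParticle →ₗ.[ℂ] TwoParticle :=
  tensorOp (rashba α β) oneOp + tensorOp oneOp (rashba α β)

/-- The bounded operator `R` is the resolvent `(T - z)⁻¹` of the operator `T` at `z`. -/
def IsResolventAt {E : Type*} [NormedAddCommGroup E] [NormedSpace ℂ E]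
    (T : E →ₗ.[ℂ] E) (z : ℂ) (R : E →L[ℂ] E) : Prop :=
  (∀ f : E, ∃ u : T.domain, (u : E) = R f ∧ T u - z • (u : E) = f) ∧
    ∀ u : T.domain, R (T u - z • (u : E)) = u

/-! ### The coupled-spin basis and the centre-of-mass coordinates -/

/-- The labels `σ = (S, s)`, `S ∈ {0, 1}`, `s ∈ {-S, …, S}`, of the basis `|S s⟩` of
`ℂ³ ⊕ ℂ¹`. -/
inductive Coupled
  | singlet
  | tripletMinus
  | tripletZero
  | tripletPlus
  deriving DecidableEq

instance : Fintype Coupled where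
  elems := {.singlet, .tripletMinus, .tripletZero, .tripletPlus}
  complete := by intro σ; cases σ <;> decide

/-- The total spin `S` of `σ = (S, s)`. -/
def Coupled.S : Coupled → ℕ
  | .singlet => 0
  | .tripletMinus => 1
  | .tripletZero => 1
  | .tripletPlus => 1

/-- The projection `s` of `σ = (S, s)`. -/
def Coupled.s : Coupled → ℤ
  | .singlet => 0
  | .tripletMinus => -1
  | .tripletZero => 0
  | .tripletPlus => 1

/-- The Clebsch-Gordan coefficients `⟨1/2 s₁, 1/2 s₂ | S s⟩` of `SU(2)`. -/
def clebschGordan (s₁ s₂ : Spin) : Coupled → ℂ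
  | .singlet =>
      if s₁ = 0 ∧ s₂ = 1 then ((1 / √2 : ℝ) : ℂ)
      else if s₁ = 1 ∧ s₂ = 0 then ((-(1 / √2) : ℝ) : ℂ) else 0
  | .tripletMinus => if s₁ = 1 ∧ s₂ = 1 then 1 else 0
  | .tripletZero => if s₁ ≠ s₂ then ((1 / √2 : ℝ) : ℂ) else 0
  | .tripletPlus => if s₁ = 0 ∧ s₂ = 0 then 1 else 0

/-- The coordinate transformation `K q = Q`, `q = (x₁, x₂)`, `Q = (x, X)` with
`x = x₁ - x₂`, `X = (x₁ + x₂) / 2`. -/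
def comMap (q : R6) : R6 :=
  WithLp.toLp 2 (q.fst - q.snd, (1 / 2 : ℝ) • (q.fst + q.snd))

theorem measurePreserving_comMap : MeasurePreserving comMap (volume : Measure R6) volume := by
  have h1 : MeasurePreserving (fun p : R3 × R3 => (p.1, p.2 + (1 / 2 : ℝ) • p.1))
      (volume.prod volume) (volume.prod volume) :=
    (MeasurePreserving.id (volume : Measure R3)).skew_product
      (g := fun x y => y + (1 / 2 : ℝ) • x) (by fun_prop)
      (Eventually.of_forall fun x => (measurePreserving_add_right volume _).map_eq)
  have h2 : MeasurePreserving (fun p : R3 × R3 => (p.1 - p.2, p.2))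
      (volume.prod volume) (volume.prod volume) := by
    have := ((Measure.measurePreserving_swap (μ := (volume : Measure R3))
      (ν := (volume : Measure R3))).comp
      ((MeasurePreserving.id (volume : Measure R3)).skew_product
        (g := fun y x => x - y) (by fun_prop)
        (Eventually.of_forall fun x => (measurePreserving_sub_right volume x).map_eq))).comp
      (Measure.measurePreserving_swap (μ := (volume : Measure R3)) (ν := (volume : Measure R3)))
    exact this
  have h := (WithLp.volume_preserving_toLp (U := R3) (V := R3)).comp
    ((h1.comp h2).comp (WithLp.volume_preserving_ofLp (U := R3) (V := R3)))
  have hK : comMap = WithLp.toLp 2 ∘ ((fun p : R3 × R3 => (p.1, p.2 + (1 / 2 : ℝ) • p.1)) ∘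
      fun p : R3 × R3 => (p.1 - p.2, p.2)) ∘ WithLp.ofLp := by
    funext q
    have : (1 / 2 : ℝ) • (q.fst + q.snd) = q.snd + (1 / 2 : ℝ) • (q.fst - q.snd) := by module
    simp only [comMap, this]
    rfl
  rw [hK]
  exact h

/-- The unitary transformation `(𝒰 f)(q) = f (K q)` of `L²(ℝ⁶)`. -/
def comUnitary : L2R6 →L[ℂ] L2R6 :=
  (Lp.compMeasurePreservingₗᵢ ℂ comMap measurePreserving_comMap).toContinuousLinearMap

/-- The Hilbert space `L²(ℝ⁶) ⊗ (ℂ³ ⊕ ℂ¹)` in components with respect to the basis `|S s⟩`. -/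
abbrev CoupledSpace := PiLp 2 (fun _ : Coupled => L2R6)

/-- The unitary map `L` from the two-particle space to `L²(ℝ⁶) ⊗ (ℂ³ ⊕ ℂ¹)`:
`(u ⊗ |s₁⟩) ⊗ (v ⊗ |s₂⟩) ↦ ∑_{S,s} ⟨1/2 s₁, 1/2 s₂ | S s⟩ 𝒰(u ⊗ v) ⊗ |S s⟩`. -/
def comCoupledMap : TwoParticle →L[ℂ] CoupledSpace :=
  ((PiLp.continuousLinearEquiv 2 ℂ (fun _ : Coupled => L2R6)).symm :
      (Coupled → L2R6) →L[ℂ] CoupledSpace) ∘L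
    ContinuousLinearMap.pi (fun σ => ∑ s₁, ∑ s₂, clebschGordan s₁ s₂ σ •
      (comUnitary ∘L PiLp.proj 2 (fun _ : Spin × Spin => L2R6) (s₁, s₂)))

/-- `R^c = L R L*`. -/
def comConj (R : TwoParticle →L[ℂ] TwoParticle) : CoupledSpace →L[ℂ] CoupledSpace :=
  comCoupledMap ∘L R ∘L ContinuousLinearMap.adjoint comCoupledMap

/-- The vector `f ⊗ |σ⟩`. -/
def tensorKet (f : L2R6) (σ : Coupled) : CoupledSpace :=
  WithLp.toLp 2 (Pi.single σ f)

/-! ### The Green function -/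

/-- `g = LIM ∫ k(· - Q') f(Q') dQ'`: the integrals over the balls `|Q'| ≤ r` converge to `g` in
`L²(ℝ⁶)` as `r → ∞`. -/
def IsLimConv (k : R6 → ℂ) (f g : L2R6) : Prop :=
  (∀ r : ℝ, ∀ᵐ Q : R6, IntegrableOn (fun Q' : R6 => k (Q - Q') * f Q')
    (Metric.closedBall 0 r)) ∧
  Tendsto (fun r : ℝ => eLpNorm
    (fun Q : R6 => (∫ Q' in Metric.closedBall (0 : R6) r, k (Q - Q') * f Q') - g Q) 2 volume)
    atTop (𝓝 0)

/-- `G = (G σ' σ)` is the Green function of the two-particle operator in the centre-of-mass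
coordinates and the coupled-spin basis: the resolvent `R(z) = (H - z)⁻¹` exists as a bounded
operator, and `R^c(z) = L R(z) L*` acts by
`R^c(z) (f(Q) ⊗ |σ⟩) = ∑_{σ'} LIM ∫ G_{σ'σ}(Q - Q') f(Q') dQ' ⊗ |σ'⟩`, `Q = K q`. -/
def IsGreenFunction (α β : ℝ) (z : ℂ) (G : Coupled → Coupled → R6 → ℂ) : Prop :=
  (∀ σ' σ, LocallyIntegrable (G σ' σ) (volume : Measure R6)) ∧
  ∃ R : TwoParticle →L[ℂ] TwoParticle, IsResolventAt (twoParticleOp α β) z R ∧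
    ∀ (f : L2R6) (σ : Coupled), ∃ g : Coupled → L2R6,
      (∀ σ', IsLimConv (G σ' σ) f (g σ')) ∧
      comConj R (tensorKet (comUnitary f) σ) = ∑ σ', tensorKet (comUnitary (g σ')) σ'

/-- The Macdonald function `K_ν(w) = ∫_0^∞ exp(-w cosh t) cosh(ν t) dt` for `Re w > 0`. -/
def macdonald (ν w : ℂ) : ℂ :=
  ∫ t in Set.Ioi (0 : ℝ), Complex.exp (-w * Complex.cosh t) * Complex.cosh (ν * t)

/-- The principal branch of the complex square root. -/
def csqrt (w : ℂ) : ℂ := w ^ (1 / 2 : ℂ)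

/-- The Kronecker symbol. -/
def kron {ι : Type*} [DecidableEq ι] (i j : ι) : ℂ := if i = j then 1 else 0

end

end Rashba

open Rashba MeasureTheory

/-!
Without spin-orbit coupling the Fourier transform diagonalises `H` in the product spin basis: the
component `(s₁, s₂)` becomes multiplication by `(2π)² |ξ|² + β (± 1 ± 1)`. As `H` is only given as
the sum of the closures of `h ⊗ 1` and `1 ⊗ h` on algebraic tensors, it is reached through
resolvents: a closed operator with bounded resolvent `r` has the graph `{(r f, f + z r f)}`, so that
the density of the tensors suffices to identify these closures.

The Zeeman term depends on `s₁` and `s₂` only through the total projection `s`, on which the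
Clebsch-Gordan coefficients are supported. Hence `L R(z) L*` acts on `𝒰 f ⊗ |σ⟩` as the free
resolvent `(-Δ - w)⁻¹` on `ℝ⁶` with `w = z - 2βs`. With `κ² = -w` and `Re κ > 0` this is the
convolution with the kernel whose Fourier transform is `1 / ((2π)² |ξ|² + κ²)`, a superposition of
heat kernels which in dimension six integrates to `κ² K₂(κ |Q|) / (8π³ |Q|²)`.
-/

namespace Rashba

noncomputable section

open MeasureTheory Filter Topology Complex FourierTransform
open scoped ENNReal SchwartzMap LineDeriv Laplacian ContDiff InnerProductSpace Convolution
open scoped BoundedContinuousFunction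

/-! ### Fourier multipliers -/

section Multiplication

variable {α : Type*} [TopologicalSpace α] [MeasurableSpace α] [OpensMeasurableSpace α]
  {μ : Measure α}

theorem memLp_top_boundedContinuous (m : α →ᵇ ℂ) : MemLp m ∞ μ :=
  memLp_top_of_bound m.continuous.measurable.aestronglyMeasurable ‖m‖
    (Eventually.of_forall m.norm_coe_le_norm)

variable (μ) in
/-- The inclusion of the bounded continuous functions in `L^∞`. -/
def boundedToLpTop : (α →ᵇ ℂ) →ₗ[ℂ] Lp ℂ ∞ μ where
  toFun m := (memLp_top_boundedContinuous m).toLp m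
  map_add' m n := (memLp_top_boundedContinuous m).toLp_add (memLp_top_boundedContinuous n)
  map_smul' c m := (memLp_top_boundedContinuous m).toLp_const_smul c

variable (μ) in
/-- Pointwise multiplication by a bounded continuous function, as an operator on `L²`. -/
def mulLpₗ : (α →ᵇ ℂ) →ₗ[ℂ] (Lp ℂ 2 μ →L[ℂ] Lp ℂ 2 μ) :=
  ((ContinuousLinearMap.mul ℂ ℂ).holderL μ ∞ 2 2).toLinearMap ∘ₗ boundedToLpTop μ

theorem coeFn_mulLpₗ (m : α →ᵇ ℂ) (f : Lp ℂ 2 μ) : mulLpₗ μ m f =ᵐ[μ] fun x => m x * f x := by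
  filter_upwards [(ContinuousLinearMap.mul ℂ ℂ).coeFn_holder (r := 2) (boundedToLpTop μ m) f,
    (memLp_top_boundedContinuous m).coeFn_toLp] with x h h'
  exact h.trans (congrArg (· * f x) h')

variable (μ) in
/-- The representation of the bounded continuous functions on `L²` by pointwise multiplication. -/
def mulLp : (α →ᵇ ℂ) →ₐ[ℂ] (Lp ℂ 2 μ →L[ℂ] Lp ℂ 2 μ) :=
  .ofLinearMap (mulLpₗ μ)
    (by
      ext1 f
      refine Lp.ext ?_
      filter_upwards [coeFn_mulLpₗ 1 f] with x h
      exact h.trans (one_mul _))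
    (fun m n => by
      ext1 f
      refine Lp.ext ?_
      filter_upwards [coeFn_mulLpₗ (m * n) f, coeFn_mulLpₗ n f,
        coeFn_mulLpₗ m (mulLpₗ μ n f)] with x h h₁ h₂
      refine h.trans (Eq.trans ?_ h₂.symm)
      rw [h₁, BoundedContinuousFunction.mul_apply, mul_assoc])

theorem coeFn_mulLp (m : α →ᵇ ℂ) (f : Lp ℂ 2 μ) : mulLp μ m f =ᵐ[μ] fun x => m x * f x :=
  coeFn_mulLpₗ m f

end Multiplication

section FourierMultiplier

variable {E : Type*} [NormedAddCommGroup E] [InnerProductSpace ℝ E] [FiniteDimensional ℝ E]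
  [MeasurableSpace E] [BorelSpace E]

variable (E) in
/-- `L²(E)`. -/
abbrev L2Space : Type _ := Lp ℂ 2 (volume : Measure E)

variable (E) in
/-- The Fourier transform of `L²(E)`. -/
abbrev fourierL2 : L2Space E ≃ₗᵢ[ℂ] L2Space E := Lp.fourierTransformₗᵢ E ℂ

/-- The Fourier multiplier operators on `L²(E)`, depending on their symbol. -/
def fourierMul : (E →ᵇ ℂ) →ₐ[ℂ] (L2Space E →L[ℂ] L2Space E) :=
  ((fourierL2 E).symm.toContinuousLinearEquiv.conjContinuousAlgEquiv.toAlgEquiv :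
    (L2Space E →L[ℂ] L2Space E) →ₐ[ℂ] (L2Space E →L[ℂ] L2Space E)).comp (mulLp volume)

theorem fourierL2_fourierMul (m : E →ᵇ ℂ) (f : L2Space E) :
    fourierL2 E (fourierMul m f) =ᵐ[volume] fun ξ => m ξ * fourierL2 E f ξ := by
  have h : fourierL2 E (fourierMul m f) = mulLp volume m (fourierL2 E f) :=
    (fourierL2 E).apply_symm_apply _
  exact h ▸ coeFn_mulLp m _

theorem eq_fourierMul_iff {m : E →ᵇ ℂ} {f g : L2Space E} :
    g = fourierMul m f ↔ fourierL2 E g =ᵐ[volume] fun ξ => m ξ * fourierL2 E f ξ :=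
  ⟨fun h => h ▸ fourierL2_fourierMul m f,
    fun h => (fourierL2 E).injective (Lp.ext (h.trans (fourierL2_fourierMul m f).symm))⟩

theorem ae_eq_of_forall_integral_schwartz_smul {F : Type*} [NormedAddCommGroup F] [NormedSpace ℂ F]
    [CompleteSpace F] {μ : Measure E} {f g : E → F} (hf : LocallyIntegrable f μ)
    (hg : LocallyIntegrable g μ) (h : ∀ φ : 𝓢(E, ℂ), ∫ x, φ x • f x ∂μ = ∫ x, φ x • g x ∂μ) :
    f =ᵐ[μ] g := by
  refine ae_eq_of_integral_contDiff_smul_eq hf hg fun φ hφ hφc => ?_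
  have hc : HasCompactSupport (Complex.ofRealCLM ∘ φ) := hφc.comp_left rfl
  have hs : ContDiff ℝ ∞ (Complex.ofRealCLM ∘ φ) := by fun_prop
  simpa using h (hc.toSchwartzMap hs)

theorem locallyIntegrable_coeFn_L2 (f : L2Space E) : LocallyIntegrable f (volume : Measure E) :=
  (Lp.memLp f).locallyIntegrable one_le_two

theorem smulLeftCLM_eq_iff {g : E → ℂ} (hg : g.HasTemperateGrowth) {f h : L2Space E} :
    TemperedDistribution.smulLeftCLM ℂ g (f : 𝓢'(E, ℂ)) = (h : 𝓢'(E, ℂ)) ↔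
      h =ᵐ[volume] fun x => g x * f x := by
  have pairing : ∀ φ : 𝓢(E, ℂ), TemperedDistribution.smulLeftCLM ℂ g (f : 𝓢'(E, ℂ)) φ =
      ∫ x, φ x • (g x * f x) := fun φ => by
    rw [TemperedDistribution.smulLeftCLM_apply_apply, Lp.toTemperedDistribution_apply]
    refine integral_congr_ae (Eventually.of_forall fun x => ?_)
    simp only [SchwartzMap.smulLeftCLM_apply_apply hg, smul_eq_mul]
    ring
  constructor
  · intro H
    have hgf : LocallyIntegrable (fun x => g x * f x) (volume : Measure E) :=
      locallyIntegrableOn_univ.1 <|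
        (locallyIntegrableOn_univ.2 (locallyIntegrable_coeFn_L2 f)).continuousOn_mul
          hg.1.continuous.continuousOn isOpen_univ.isLocallyClosed
    refine ae_eq_of_forall_integral_schwartz_smul (locallyIntegrable_coeFn_L2 h) hgf fun φ => ?_
    rw [← pairing, H, Lp.toTemperedDistribution_apply]
  · intro H
    ext φ
    rw [pairing, Lp.toTemperedDistribution_apply]
    exact integral_congr_ae (H.symm.mono fun x hx => congrArg (φ x • ·) hx)

theorem continuous_fourier {f : E → ℂ} (hf : Integrable f) : Continuous (𝓕 f) :=
  VectorFourier.fourierIntegral_continuous Real.continuous_fourierChar continuous_inner hf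

theorem integral_fourier_schwartz_smul (φ : 𝓢(E, ℂ)) {f : E → ℂ} (hf : Integrable f) :
    ∫ ξ, 𝓕 φ ξ • f ξ = ∫ x, φ x • 𝓕 f x := by
  have h := VectorFourier.integral_fourierIntegral_smul_eq_flip (L := innerₗ E)
    Real.continuous_fourierChar continuous_inner
    (μ := (volume : Measure E)) (ν := (volume : Measure E)) φ.integrable hf
  rwa [flip_innerₗ] at h

theorem integral_fourier_schwartz_smul_L2 (φ : 𝓢(E, ℂ)) (g : L2Space E) :
    ∫ ξ, 𝓕 φ ξ • g ξ = ∫ x, φ x • fourierL2 E g x := by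
  have h := congrArg (fun T => T φ) (Lp.fourier_toTemperedDistribution_eq g)
  simp only [TemperedDistribution.fourier_apply, Lp.toTemperedDistribution_apply] at h
  exact h

theorem coeFn_fourierL2_toLp {f : E → ℂ} (h1 : Integrable f) (h2 : MemLp f 2) :
    fourierL2 E (h2.toLp f) =ᵐ[volume] 𝓕 f := by
  refine ae_eq_of_forall_integral_schwartz_smul (locallyIntegrable_coeFn_L2 _)
    (continuous_fourier h1).locallyIntegrable fun φ => ?_
  calc
    ∫ ξ, φ ξ • fourierL2 E (h2.toLp f) ξ = ∫ x, 𝓕 φ x • h2.toLp f x :=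
      (integral_fourier_schwartz_smul_L2 φ _).symm
    _ = ∫ x, 𝓕 φ x • f x :=
      integral_congr_ae (h2.coeFn_toLp.mono fun x hx => congrArg (𝓕 φ x • ·) hx)
    _ = ∫ ξ, φ ξ • 𝓕 f ξ := integral_fourier_schwartz_smul φ h1

end FourierMultiplier

section Diagonal

variable {ι : Type*}

/-- The representation of families of operators by diagonal operators. -/
def diagOp [Fintype ι] {H : Type*} [NormedAddCommGroup H] [NormedSpace ℂ H] :
    (ι → H →L[ℂ] H) →ₐ[ℂ] (PiLp 2 (fun _ : ι => H) →L[ℂ] PiLp 2 (fun _ : ι => H)) where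
  toFun T := ((PiLp.continuousLinearEquiv 2 ℂ (fun _ : ι => H)).symm :
      (ι → H) →L[ℂ] PiLp 2 (fun _ : ι => H)) ∘L
    ContinuousLinearMap.pi (fun i => T i ∘L PiLp.proj 2 (fun _ : ι => H) i)
  map_one' := rfl
  map_mul' _ _ := rfl
  map_zero' := rfl
  map_add' _ _ := rfl
  commutes' _ := rfl

variable {E : Type*} [NormedAddCommGroup E] [InnerProductSpace ℝ E] [FiniteDimensional ℝ E]
  [MeasurableSpace E] [BorelSpace E]

/-- The diagonal operators with Fourier multipliers `m i` as entries, depending on `m`. -/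
def diagMul [Fintype ι] : (ι → E →ᵇ ℂ) →ₐ[ℂ]
    (PiLp 2 (fun _ : ι => L2Space E) →L[ℂ] PiLp 2 (fun _ : ι => L2Space E)) :=
  diagOp.comp (fourierMul.compLeft ι)

theorem diagMul_apply [Fintype ι] (m : ι → E →ᵇ ℂ) (f : PiLp 2 fun _ : ι => L2Space E) (i : ι) :
    diagMul m f i = fourierMul (m i) (f i) := rfl

/-- `A` is the maximal multiplication operator by the symbols `a i` in Fourier space. -/
def IsFourierDiagonal (a : ι → E → ℂ)
    (A : PiLp 2 (fun _ : ι => L2Space E) →ₗ.[ℂ] PiLp 2 (fun _ : ι => L2Space E)) : Prop :=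
  ∀ u w, (u, w) ∈ A.graph ↔
    ∀ i, fourierL2 E (w i) =ᵐ[volume] fun ξ => a i ξ * fourierL2 E (u i) ξ

end Diagonal

section Resolvent

variable {H : Type*} [NormedAddCommGroup H] [NormedSpace ℂ H] {A : H →ₗ.[ℂ] H} {z : ℂ}
  {R : H →L[ℂ] H}

theorem isResolventAt_iff_mem_graph :
    IsResolventAt A z R ↔ ∀ u w, (u, w) ∈ A.graph ↔ R (w - z • u) = u := by
  constructor
  · rintro ⟨hright, hleft⟩ u w
    rw [LinearPMap.mem_graph_iff]
    constructor
    · rintro ⟨y, rfl, rfl⟩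
      exact hleft y
    · intro h
      obtain ⟨y, hy, hAy⟩ := hright (w - z • u)
      refine ⟨y, hy.trans h, ?_⟩
      rwa [hy, h, sub_left_inj] at hAy
  · intro h
    refine ⟨fun f => ?_, fun u => (h _ _).1 (A.mem_graph u)⟩
    obtain ⟨y, hy, hAy⟩ := (A.mem_graph_iff).1 ((h (R f) (f + z • R f)).2 (by simp))
    exact ⟨y, hy, by rw [hAy, hy, add_sub_cancel_right]⟩

theorem IsResolventAt.unique {R' : H →L[ℂ] H} (h : IsResolventAt A z R)
    (h' : IsResolventAt A z R') : R = R' := by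
  ext1 f
  obtain ⟨u, hu, hAu⟩ := h.1 f
  rw [← hu, ← h'.2 u, hAu]

end Resolvent

section DiagonalResolvent

variable {ι : Type*} {E : Type*} [NormedAddCommGroup E] [InnerProductSpace ℝ E]
  [FiniteDimensional ℝ E] [MeasurableSpace E] [BorelSpace E]
  {A B : PiLp 2 (fun _ : ι => L2Space E) →ₗ.[ℂ] PiLp 2 (fun _ : ι => L2Space E)}
  {a b : ι → E → ℂ} {z : ℂ}

theorem fourierL2_add (f g : L2Space E) :
    fourierL2 E (f + g) =ᵐ[volume] fun ξ => fourierL2 E f ξ + fourierL2 E g ξ :=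
  (fourierL2 E).map_add f g ▸ Lp.coeFn_add _ _

theorem fourierL2_sub (f g : L2Space E) :
    fourierL2 E (f - g) =ᵐ[volume] fun ξ => fourierL2 E f ξ - fourierL2 E g ξ :=
  (fourierL2 E).map_sub f g ▸ Lp.coeFn_sub _ _

theorem fourierL2_smul (c : ℂ) (f : L2Space E) :
    fourierL2 E (c • f) =ᵐ[volume] fun ξ => c * fourierL2 E f ξ :=
  (fourierL2 E).map_smul c f ▸ Lp.coeFn_smul _ _

theorem fourierMul_sub_smul_eq_iff {m : E → ℂ} {r : E →ᵇ ℂ} (hr : ∀ ξ, r ξ * (m ξ - z) = 1)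
    (u w : L2Space E) :
    fourierMul r (w - z • u) = u ↔
      fourierL2 E w =ᵐ[volume] fun ξ => m ξ * fourierL2 E u ξ := by
  rw [eq_comm, eq_fourierMul_iff]
  constructor <;> intro h <;>
    filter_upwards [h, fourierL2_sub w (z • u), fourierL2_smul z u] with ξ h₁ h₂ h₃
  · rw [h₂, h₃] at h₁
    linear_combination (-(m ξ - z)) * h₁ - (fourierL2 E w ξ - z * fourierL2 E u ξ) * hr ξ
  · rw [h₂, h₃]
    linear_combination (-r ξ) * h₁ - fourierL2 E u ξ * hr ξ

theorem isFourierDiagonal_iff_isResolventAt [Fintype ι] {r : ι → E →ᵇ ℂ}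
    (hr : ∀ i ξ, r i ξ * (a i ξ - z) = 1) :
    IsFourierDiagonal a A ↔ IsResolventAt A z (diagMul r) := by
  rw [isResolventAt_iff_mem_graph]
  refine forall₂_congr fun u w => iff_congr Iff.rfl ?_
  simp only [← fourierMul_sub_smul_eq_iff (hr _), PiLp.ext_iff, diagMul_apply, PiLp.sub_apply,
    PiLp.smul_apply]

theorem IsFourierDiagonal.add (hA : IsFourierDiagonal a A) (hB : IsFourierDiagonal b B)
    {p : ι → E →ᵇ ℂ} (hp : ∀ i ξ, p i ξ * (a i ξ + b i ξ - z) = a i ξ) :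
    IsFourierDiagonal (a + b) (A + B) := by
  intro u w
  simp only [LinearPMap.mem_graph_iff]
  constructor
  · rintro ⟨⟨u, hu, hu'⟩, rfl, rfl⟩ i
    filter_upwards [(hA _ _).1 (A.mem_graph ⟨u, hu⟩) i, (hB _ _).1 (B.mem_graph ⟨u, hu'⟩) i,
      fourierL2_add (A ⟨u, hu⟩ i) (B ⟨u, hu'⟩ i)] with ξ h₁ h₂ h
    exact h.trans (by rw [h₁, h₂]; exact (add_mul _ _ _).symm)
  · intro h
    let v : PiLp 2 fun _ : ι => L2Space E :=
      WithLp.toLp 2 fun i => fourierMul (p i) (w i - z • u i)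
    have hv : ∀ i, fourierL2 E (v i) =ᵐ[volume] fun ξ => a i ξ * fourierL2 E (u i) ξ := fun i => by
      filter_upwards [h i, fourierL2_fourierMul (p i) (w i - z • u i),
        fourierL2_sub (w i) (z • u i), fourierL2_smul z (u i)] with ξ h₁ h₂ h₃ h₄
      rw [h₂, h₃, h₄, h₁, ← hp, Pi.add_apply, Pi.add_apply]
      ring
    have hw : ∀ i, fourierL2 E ((w - v) i) =ᵐ[volume] fun ξ => b i ξ * fourierL2 E (u i) ξ :=
      fun i => by
        filter_upwards [h i, hv i, fourierL2_sub (w i) (v i)] with ξ h₁ h₂ h₃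
        refine h₃.trans ?_
        rw [h₁, h₂, Pi.add_apply, Pi.add_apply, add_mul, add_sub_cancel_left]
    obtain ⟨⟨_, hu⟩, rfl, hAu⟩ := A.mem_graph_iff.1 ((hA u v).2 hv)
    obtain ⟨⟨_, hu'⟩, rfl, hBu⟩ := B.mem_graph_iff.1 ((hB _ (w - v)).2 hw)
    refine ⟨⟨_, hu, hu'⟩, rfl, ?_⟩
    rw [LinearPMap.add_apply]
    exact (congrArg₂ (· + ·) hAu hBu).trans (add_sub_cancel v w)

end DiagonalResolvent

section Sobolev

variable {E : Type*} [NormedAddCommGroup E] [InnerProductSpace ℝ E] [FiniteDimensional ℝ E]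
  [MeasurableSpace E] [BorelSpace E]

theorem memSobolev_two_of_fourierL2 {u v : L2Space E}
    (h : fourierL2 E v =ᵐ[volume] fun ξ => ‖ξ‖ ^ 2 * fourierL2 E u ξ) :
    TemperedDistribution.MemSobolev 2 2 (u : 𝓢'(E, ℂ)) := by
  rw [TemperedDistribution.memSobolev_iff_exists_smulLeftCLM_fourier]
  refine ⟨fourierL2 E (u + v), ?_⟩
  rw [Lp.fourier_toTemperedDistribution_eq]
  refine (smulLeftCLM_eq_iff (by fun_prop)).2 ?_
  filter_upwards [h, fourierL2_add u v] with ξ h₁ h₂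
  rw [div_self two_ne_zero, Real.rpow_one]
  refine h₂.trans ?_
  rw [h₁]
  push_cast
  exact (one_add_mul _ _).symm

end Sobolev

/-- The eigenvalue `±1` of `2 S³`. -/
def spinSign (s : Spin) : ℝ := if s = 0 then 1 else -1

theorem two_mul_spinOp_two (s s' : Spin) :
    2 * spinOp 2 s s' = if s' = s then (spinSign s : ℂ) else 0 := by
  fin_cases s <;> fin_cases s' <;> simp [spinOp, pauli, spinSign]

theorem rashbaExpr_no_coupling (β : ℝ) (u : OneParticle) (s : Spin) :
    rashbaExpr 0 β u s = -Δ (toDistr (u s)) + ((β * spinSign s : ℝ) : ℂ) • toDistr (u s) := by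
  fin_cases s <;>
  · simp only [rashbaExpr, two_mul_spinOp_two, Fin.sum_univ_two, ofReal_zero, ofReal_mul,
      Fin.zero_eta, Fin.mk_one, if_true, one_ne_zero, zero_ne_one, if_false]
    module

/-- The symbol of the component `s` of the one-particle operator without spin-orbit coupling. -/
def rashbaSymbol (β : ℝ) (s : Spin) : C(R3, ℝ) :=
  ⟨fun ξ => (2 * Real.pi) ^ 2 * ‖ξ‖ ^ 2 + β * spinSign s, by fun_prop⟩

theorem rashbaSymbol_apply (β : ℝ) (s : Spin) (ξ : R3) :
    rashbaSymbol β s ξ = (2 * Real.pi) ^ 2 * ‖ξ‖ ^ 2 + β * spinSign s := rfl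

theorem hasTemperateGrowth_rashbaSymbol (β : ℝ) (s : Spin) :
    (fun ξ => (rashbaSymbol β s ξ : ℂ)).HasTemperateGrowth := by
  simp only [rashbaSymbol_apply]
  fun_prop

theorem fourier_rashbaExpr (β : ℝ) (u : OneParticle) (s : Spin) :
    𝓕 (rashbaExpr 0 β u s) = TemperedDistribution.smulLeftCLM ℂ
      (fun ξ => (rashbaSymbol β s ξ : ℂ)) (𝓕 (toDistr (u s))) := by
  have hsum : (fun ξ : R3 => (rashbaSymbol β s ξ : ℂ)) =
      ((((2 * Real.pi) ^ 2 : ℝ) : ℂ) • fun ξ : R3 => ((‖ξ‖ ^ 2 : ℝ) : ℂ)) +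
        fun _ => ((β * spinSign s : ℝ) : ℂ) := by
    ext ξ
    simp [rashbaSymbol_apply]
  rw [rashbaExpr_no_coupling, TemperedDistribution.laplacian_eq_fourierMultiplierCLM,
    TemperedDistribution.fourierMultiplierCLM_apply, hsum,
    TemperedDistribution.smulLeftCLM_add (by fun_prop) (by fun_prop),
    TemperedDistribution.smulLeftCLM_smul (by fun_prop),
    FourierTransform.fourier_add, FourierTransform.fourier_smul, neg_smul, neg_neg,
    ← Complex.coe_smul, FourierTransform.fourier_smul, FourierTransform.fourier_fourierInv_eq,
    add_apply, smul_apply,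
    TemperedDistribution.smulLeftCLM_const]

theorem fourier_toDistr (u : L2R3) : 𝓕 (toDistr u) = ((fourierL2 R3 u : L2R3) : 𝓢'(R3, ℂ)) :=
  Lp.fourier_toTemperedDistribution_eq u

theorem toDistr_eq_rashbaExpr_iff (β : ℝ) (u : OneParticle) (w : L2R3) (s : Spin) :
    toDistr w = rashbaExpr 0 β u s ↔
      fourierL2 R3 w =ᵐ[volume] fun ξ => rashbaSymbol β s ξ * fourierL2 R3 (u s) ξ := by
  have hinj : Function.Injective (fun T : 𝓢'(R3, ℂ) => 𝓕 T) :=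
    Function.LeftInverse.injective (g := fun T => 𝓕⁻ T) FourierTransform.fourierInv_fourier_eq
  rw [← hinj.eq_iff, fourier_rashbaExpr, fourier_toDistr, fourier_toDistr, eq_comm,
    smulLeftCLM_eq_iff (hasTemperateGrowth_rashbaSymbol β s)]

theorem mem_rashbaGraph_iff (β : ℝ) (u w : OneParticle) :
    (u, w) ∈ rashbaGraph 0 β ↔
      ∀ s, fourierL2 R3 (w s) =ᵐ[volume] fun ξ => rashbaSymbol β s ξ * fourierL2 R3 (u s) ξ := by
  refine ⟨fun h s => (toDistr_eq_rashbaExpr_iff β u (w s) s).1 (h.2 s), fun h =>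
    ⟨fun s => ?_, fun s => (toDistr_eq_rashbaExpr_iff β u (w s) s).2 (h s)⟩⟩
  set c : ℂ := ((2 * Real.pi) ^ 2)⁻¹
  set b : ℂ := ((β * spinSign s : ℝ) : ℂ)
  refine memSobolev_two_of_fourierL2 (v := c • (w s - b • u s)) ?_
  filter_upwards [h s, fourierL2_smul c (w s - b • u s), fourierL2_sub (w s) (b • u s),
    fourierL2_smul b (u s)] with ξ h₁ h₂ h₃ h₄
  have hpi : (Real.pi : ℂ) ≠ 0 := by exact_mod_cast Real.pi_ne_zero
  rw [h₂, h₃, h₄, h₁, ← sub_mul, ← mul_assoc]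
  simp [rashbaSymbol_apply, b, c, hpi]

theorem isFourierDiagonal_rashba (β : ℝ) :
    IsFourierDiagonal (fun s ξ => (rashbaSymbol β s ξ : ℂ)) (rashba 0 β) := by
  intro u w
  have hgraph : (rashba 0 β).graph = rashbaGraph 0 β := by
    refine Submodule.toLinearPMap_graph_eq _ ?_
    rintro ⟨x, y⟩ hx (rfl : x = 0)
    ext1 s
    refine (fourierL2 R3).injective (Lp.ext ?_)
    have h0 : fourierL2 R3 ((0 : OneParticle) s) = 0 := map_zero _
    filter_upwards [(mem_rashbaGraph_iff β 0 y).1 hx s, Lp.coeFn_zero ℂ 2 (volume : Measure R3)]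
      with ξ h₁ h₂
    rw [h₁, h0, h₂, Pi.zero_apply, mul_zero]
  rw [hgraph, mem_rashbaGraph_iff]

section Tensor

theorem quasiMeasurePreserving_fst_R6 :
    Measure.QuasiMeasurePreserving (fun q : R6 => q.fst) volume volume :=
  Measure.quasiMeasurePreserving_fst.comp
    (WithLp.volume_preserving_ofLp (U := R3) (V := R3)).quasiMeasurePreserving

theorem quasiMeasurePreserving_snd_R6 :
    Measure.QuasiMeasurePreserving (fun q : R6 => q.snd) volume volume :=
  Measure.quasiMeasurePreserving_snd.comp
    (WithLp.volume_preserving_ofLp (U := R3) (V := R3)).quasiMeasurePreserving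

theorem integral_R6 {F : Type*} [NormedAddCommGroup F] [NormedSpace ℝ F] (f : R6 → F) :
    ∫ q, f q = ∫ p : R3 × R3, f (WithLp.toLp 2 p) :=
  ((WithLp.volume_preserving_toLp (U := R3) (V := R3)).integral_comp
    (MeasurableEquiv.toLp 2 (R3 × R3)).measurableEmbedding f).symm

theorem coeFn_tensorFun (u v : L2R3) :
    tensorFun u v =ᵐ[volume] fun q : R6 => u q.fst * v q.snd :=
  (memLp_tensor u v).coeFn_toLp

theorem tensorFun_toLp {f g : R3 → ℂ} (hf : MemLp f 2) (hg : MemLp g 2) :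
    tensorFun (hf.toLp f) (hg.toLp g) =ᵐ[volume] fun q : R6 => f q.fst * g q.snd := by
  filter_upwards [coeFn_tensorFun (hf.toLp f) (hg.toLp g),
    quasiMeasurePreserving_fst_R6.ae hf.coeFn_toLp,
    quasiMeasurePreserving_snd_R6.ae hg.coeFn_toLp] with q h h₁ h₂
  rw [h, h₁, h₂]

theorem inner_tensorFun (u v u' v' : L2R3) :
    ⟪tensorFun u v, tensorFun u' v'⟫_ℂ = ⟪u, u'⟫_ℂ * ⟪v, v'⟫_ℂ := by
  rw [L2.inner_def, L2.inner_def, L2.inner_def, ← integral_prod_mul]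
  refine Eq.trans (integral_congr_ae ?_) (integral_R6 fun q : R6 =>
    ⟪u q.fst, u' q.fst⟫_ℂ * ⟪v q.snd, v' q.snd⟫_ℂ)
  filter_upwards [coeFn_tensorFun u v, coeFn_tensorFun u' v'] with q h h'
  simp only [h, h', RCLike.inner_apply, map_mul]
  ring

theorem norm_tensorFun (u v : L2R3) : ‖tensorFun u v‖ = ‖u‖ * ‖v‖ := by
  have h := inner_tensorFun u v u v
  simp only [inner_self_eq_norm_sq_to_K] at h
  norm_cast at h
  rwa [← mul_pow, sq_eq_sq₀ (norm_nonneg _) (by positivity)] at h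

theorem tensorFun_add_left (u u' v : L2R3) :
    tensorFun (u + u') v = tensorFun u v + tensorFun u' v := by
  refine Lp.ext ?_
  filter_upwards [coeFn_tensorFun (u + u') v, Lp.coeFn_add (tensorFun u v) (tensorFun u' v),
    coeFn_tensorFun u v, coeFn_tensorFun u' v,
    quasiMeasurePreserving_fst_R6.ae (Lp.coeFn_add u u')] with q h h₁ h₂ h₃ h₄
  rw [h, h₁, Pi.add_apply, h₂, h₃, h₄, Pi.add_apply, add_mul]

theorem tensorFun_smul_left (c : ℂ) (u v : L2R3) :
    tensorFun (c • u) v = c • tensorFun u v := by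
  refine Lp.ext ?_
  filter_upwards [coeFn_tensorFun (c • u) v, Lp.coeFn_smul c (tensorFun u v),
    coeFn_tensorFun u v, quasiMeasurePreserving_fst_R6.ae (Lp.coeFn_smul c u)] with q h h₁ h₂ h₃
  rw [h, h₁, Pi.smul_apply, h₂, h₃, Pi.smul_apply, smul_mul_assoc]

theorem tensorFun_add_right (u v v' : L2R3) :
    tensorFun u (v + v') = tensorFun u v + tensorFun u v' := by
  refine Lp.ext ?_
  filter_upwards [coeFn_tensorFun u (v + v'), Lp.coeFn_add (tensorFun u v) (tensorFun u v'),
    coeFn_tensorFun u v, coeFn_tensorFun u v',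
    quasiMeasurePreserving_snd_R6.ae (Lp.coeFn_add v v')] with q h h₁ h₂ h₃ h₄
  rw [h, h₁, Pi.add_apply, h₂, h₃, h₄, Pi.add_apply, mul_add]

theorem tensorFun_smul_right (c : ℂ) (u v : L2R3) :
    tensorFun u (c • v) = c • tensorFun u v := by
  refine Lp.ext ?_
  filter_upwards [coeFn_tensorFun u (c • v), Lp.coeFn_smul c (tensorFun u v),
    coeFn_tensorFun u v, quasiMeasurePreserving_snd_R6.ae (Lp.coeFn_smul c v)] with q h h₁ h₂ h₃
  rw [h, h₁, Pi.smul_apply, h₂, h₃, Pi.smul_apply, mul_smul_comm]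

/-- The tensor product of `L²` functions as a continuous bilinear map. -/
def tensorL : L2R3 →L[ℂ] L2R3 →L[ℂ] L2R6 :=
  LinearMap.mkContinuous₂ (LinearMap.mk₂ ℂ tensorFun tensorFun_add_left tensorFun_smul_left
    tensorFun_add_right tensorFun_smul_right) 1 fun u v => by
      rw [LinearMap.mk₂_apply, norm_tensorFun, one_mul]

theorem tensorL_apply (u v : L2R3) : tensorL u v = tensorFun u v := rfl

theorem fourier_tensor (f g : R3 → ℂ) (ξ : R6) :
    𝓕 (fun q : R6 => f q.fst * g q.snd) ξ = 𝓕 f ξ.fst * 𝓕 g ξ.snd := by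
  rw [Real.fourier_eq, Real.fourier_eq, Real.fourier_eq, integral_R6]
  refine Eq.trans (integral_congr_ae (Eventually.of_forall fun p => ?_)) (integral_prod_mul
    (fun x : R3 => Real.fourierChar (-⟪x, ξ.fst⟫_ℝ) • f x)
    fun x : R3 => Real.fourierChar (-⟪x, ξ.snd⟫_ℝ) • g x)
  simp only [WithLp.prod_inner_apply, neg_add, AddChar.map_add_eq_mul, Circle.smul_def,
    smul_eq_mul, Circle.coe_mul, WithLp.toLp_fst, WithLp.toLp_snd, WithLp.ofLp_fst,
    WithLp.ofLp_snd]
  ring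

theorem fourierL2_tensorFun_toLp {f g : R3 → ℂ} (hf : Integrable f) (hg : Integrable g)
    (hf₂ : MemLp f 2) (hg₂ : MemLp g 2) :
    fourierL2 R6 (tensorFun (hf₂.toLp f) (hg₂.toLp g)) =
      tensorFun (fourierL2 R3 (hf₂.toLp f)) (fourierL2 R3 (hg₂.toLp g)) := by
  have hfg : Integrable (fun q : R6 => f q.fst * g q.snd) :=
    (WithLp.volume_preserving_ofLp (U := R3) (V := R3)).integrable_comp_of_integrable
      (g := fun p : R3 × R3 => f p.1 * g p.2) (hf.mul_prod hg)
  have hfg₂ := (memLp_congr_ae (tensorFun_toLp hf₂ hg₂)).1 (Lp.memLp _)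
  have htoLp : tensorFun (hf₂.toLp f) (hg₂.toLp g) = hfg₂.toLp _ :=
    Lp.ext ((tensorFun_toLp hf₂ hg₂).trans hfg₂.coeFn_toLp.symm)
  refine Lp.ext ?_
  rw [htoLp]
  filter_upwards [coeFn_fourierL2_toLp hfg hfg₂,
    coeFn_tensorFun (fourierL2 R3 (hf₂.toLp f)) (fourierL2 R3 (hg₂.toLp g)),
    quasiMeasurePreserving_fst_R6.ae (coeFn_fourierL2_toLp hf hf₂),
    quasiMeasurePreserving_snd_R6.ae (coeFn_fourierL2_toLp hg hg₂)] with ξ h h₁ h₂ h₃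
  rw [h, h₁, h₂, h₃, fourier_tensor]

theorem fourierL2_tensorFun (u v : L2R3) :
    fourierL2 R6 (tensorFun u v) = tensorFun (fourierL2 R3 u) (fourierL2 R3 v) := by
  have hd : DenseRange (SchwartzMap.toLpCLM ℂ (E := R3) ℂ 2 volume) :=
    SchwartzMap.denseRange_toLpCLM (p := 2) ENNReal.ofNat_ne_top
  refine hd.induction_on₂ (p := fun u v : L2R3 =>
    fourierL2 R6 (tensorL u v) = tensorL (fourierL2 R3 u) (fourierL2 R3 v)) ?_
    (fun φ ψ => fourierL2_tensorFun_toLp φ.integrable ψ.integrable (φ.memLp 2) (ψ.memLp 2)) u v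
  exact isClosed_eq (by fun_prop) (by fun_prop)

/-- The projection `(x₁, x₂) ↦ x₁` of `ℝ⁶`. -/
def fstR6 : C(R6, R3) := ⟨fun ξ => ξ.fst, by fun_prop⟩

/-- The projection `(x₁, x₂) ↦ x₂` of `ℝ⁶`. -/
def sndR6 : C(R6, R3) := ⟨fun ξ => ξ.snd, by fun_prop⟩

theorem fourierMul_fst_tensorFun (m : R3 →ᵇ ℂ) (u v : L2R3) :
    fourierMul (m.compContinuous fstR6) (tensorFun u v) = tensorFun (fourierMul m u) v := by
  refine (eq_fourierMul_iff.2 ?_).symm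
  rw [fourierL2_tensorFun, fourierL2_tensorFun]
  filter_upwards [coeFn_tensorFun (fourierL2 R3 (fourierMul m u)) (fourierL2 R3 v),
    coeFn_tensorFun (fourierL2 R3 u) (fourierL2 R3 v),
    quasiMeasurePreserving_fst_R6.ae (fourierL2_fourierMul m u)] with ξ h h₁ h₂
  rw [h, h₁, h₂, mul_assoc]
  rfl

theorem fourierMul_snd_tensorFun (m : R3 →ᵇ ℂ) (u v : L2R3) :
    fourierMul (m.compContinuous sndR6) (tensorFun u v) = tensorFun u (fourierMul m v) := by
  refine (eq_fourierMul_iff.2 ?_).symm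
  rw [fourierL2_tensorFun, fourierL2_tensorFun]
  filter_upwards [coeFn_tensorFun (fourierL2 R3 u) (fourierL2 R3 (fourierMul m v)),
    coeFn_tensorFun (fourierL2 R3 u) (fourierL2 R3 v),
    quasiMeasurePreserving_snd_R6.ae (fourierL2_fourierMul m v)] with ξ h h₁ h₂
  rw [h, h₁, h₂, mul_left_comm]
  rfl

end Tensor

section Density

theorem ae_eq_zero_of_forall_setIntegral_prod {α β F : Type*} [MeasurableSpace α]
    [MeasurableSpace β] [NormedAddCommGroup F] [NormedSpace ℝ F] [CompleteSpace F]
    {μ : Measure (α × β)} {g : α × β → F} (hg : Integrable g μ)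
    (h : ∀ s t, MeasurableSet s → MeasurableSet t → ∫ x in s ×ˢ t, g x ∂μ = 0) :
    g =ᵐ[μ] 0 := by
  suffices ∀ S, MeasurableSet S → ∫ x in S, g x ∂μ = 0 from
    hg.ae_eq_zero_of_forall_setIntegral_eq_zero fun S hS _ => this S hS
  intro S hS
  induction S, hS using MeasurableSpace.induction_on_inter generateFrom_prod.symm
    isPiSystem_prod with
  | empty => exact setIntegral_empty
  | basic S hS =>
    obtain ⟨s, hs, t, ht, rfl⟩ := hS
    exact h s t hs ht
  | compl S hS ih =>
    have huniv := h Set.univ Set.univ .univ .univ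
    rwa [Set.univ_prod_univ, setIntegral_univ, ← integral_add_compl hS hg, ih, zero_add] at huniv
  | iUnion f hd hm ih =>
    rw [integral_iUnion hm hd hg.integrableOn, tsum_congr ih, tsum_zero]

theorem inner_tensorFun_indicator {f g : R3 → ℂ} (hf : MemLp f 2) (hg : MemLp g 2) {s t : Set R3}
    (hs : MeasurableSet s) (ht : MeasurableSet t) (w : L2R6) :
    ⟪tensorFun ((hf.indicator hs).toLp _) ((hg.indicator ht).toLp _), w⟫_ℂ =
      ∫ p in s ×ˢ t, ⟪f p.1 * g p.2, w (WithLp.toLp 2 p)⟫_ℂ := by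
  rw [L2.inner_def, ← integral_indicator (hs.prod ht)]
  refine Eq.trans (integral_congr_ae ?_) (integral_R6 fun q : R6 =>
    (s ×ˢ t).indicator (fun p => ⟪f p.1 * g p.2, w (WithLp.toLp 2 p)⟫_ℂ) (WithLp.ofLp q))
  filter_upwards [tensorFun_toLp (hf.indicator hs) (hg.indicator ht)] with q h
  by_cases h₁ : q.fst ∈ s <;> by_cases h₂ : q.snd ∈ t <;> simp [h, h₁, h₂]

theorem exists_memLp_two_forall_ne_zero : ∃ f : R3 → ℂ, MemLp f 2 ∧ ∀ x, f x ≠ 0 := by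
  have hpos : ∀ x : R3, 0 < 1 + ‖x‖ ^ 2 := fun x => by positivity
  refine ⟨fun x => ((1 + ‖x‖ ^ 2)⁻¹ : ℝ), ?_, fun x => ofReal_ne_zero.2 (inv_pos.2 (hpos x)).ne'⟩
  have hcont : Continuous fun x : R3 => (((1 + ‖x‖ ^ 2)⁻¹ : ℝ) : ℂ) :=
    continuous_ofReal.comp (Continuous.inv₀ (by fun_prop) fun x => (hpos x).ne')
  rw [memLp_two_iff_integrable_sq_norm hcont.aestronglyMeasurable]
  refine (integrable_rpow_neg_one_add_norm_sq (E := R3) (μ := volume) (r := 4) ?_).congr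
    (Eventually.of_forall fun x => ?_)
  · rw [finrank_euclideanSpace_fin]
    norm_num
  · have hexp : (-4 / 2 : ℝ) = -(2 : ℕ) := by norm_num
    simp only [hexp, Real.rpow_neg (hpos x).le, Real.rpow_natCast, norm_real, Real.norm_eq_abs,
      sq_abs, inv_pow]

theorem eq_zero_of_forall_inner_tensorFun (w : L2R6) (h : ∀ u v, ⟪tensorFun u v, w⟫_ℂ = 0) :
    w = 0 := by
  obtain ⟨f, hf, hf0⟩ := exists_memLp_two_forall_ne_zero
  have hint : Integrable (fun p : R3 × R3 => ⟪f p.1 * f p.2, w (WithLp.toLp 2 p)⟫_ℂ) := by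
    refine (WithLp.volume_preserving_toLp (U := R3) (V := R3)).integrable_comp_of_integrable
      (g := fun q => ⟪f q.fst * f q.snd, w q⟫_ℂ) ?_
    refine (L2.integrable_inner (𝕜 := ℂ) (tensorFun (hf.toLp f) (hf.toLp f)) w).congr ?_
    filter_upwards [tensorFun_toLp hf hf] with q hq
    rw [hq]
  have hzero := ae_eq_zero_of_forall_setIntegral_prod hint fun s t hs ht => by
    rw [← inner_tensorFun_indicator hf hf hs ht, h]
  refine Lp.ext ?_
  filter_upwards [Lp.coeFn_zero ℂ 2 (volume : Measure R6),
    (WithLp.volume_preserving_ofLp (U := R3) (V := R3)).quasiMeasurePreserving.ae hzero]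
    with q h₀ hq
  rw [h₀]
  simpa [hf0] using hq

/-- The span of the elementary tensors. -/
def tensorSpan : Submodule ℂ TwoParticle :=
  Submodule.span ℂ {f | ∃ u v : OneParticle, f = tensorVec u v}

theorem tensorVec_single (s : Spin × Spin) (u v : L2R3) :
    tensorVec (PiLp.single 2 s.1 u) (PiLp.single 2 s.2 v) = PiLp.single 2 s (tensorFun u v) := by
  ext1 t
  change tensorL ((PiLp.single 2 s.1 u : OneParticle) t.1)
    ((PiLp.single 2 s.2 v : OneParticle) t.2) = _
  by_cases ht : t = s
  · subst ht
    simp only [PiLp.single_eq_same, tensorL_apply]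
  · rw [PiLp.single_eq_of_ne 2 ht]
    rcases not_and_or.1 (mt Prod.ext_iff.2 ht) with h | h <;> simp [h]

theorem inner_single_left {ι H : Type*} [Fintype ι] [DecidableEq ι] [NormedAddCommGroup H]
    [InnerProductSpace ℂ H] (i : ι) (a : H) (w : PiLp 2 fun _ : ι => H) :
    ⟪PiLp.single 2 i a, w⟫_ℂ = ⟪a, w i⟫_ℂ := by
  rw [PiLp.inner_apply, Finset.sum_eq_single i (fun j _ hj => by simp [hj]) (by simp),
    PiLp.single_eq_same]

theorem topologicalClosure_tensorSpan : tensorSpan.topologicalClosure = ⊤ := by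
  rw [Submodule.topologicalClosure_eq_top_iff, Submodule.eq_bot_iff]
  intro w hw
  ext1 s
  refine eq_zero_of_forall_inner_tensorFun _ fun u v => ?_
  rw [← inner_single_left, ← tensorVec_single]
  exact (Submodule.mem_orthogonal _ _).1 hw _ (Submodule.subset_span ⟨_, _, rfl⟩)

end Density

section Closure

variable {H : Type*} [NormedAddCommGroup H] [NormedSpace ℂ H]

/-- The map `f ↦ ((A - z)⁻¹ f, A (A - z)⁻¹ f)` onto the graph of the operator `A` with resolvent
`T` at `z`. -/
def resolventGraphMap (z : ℂ) (T : H →L[ℂ] H) : H →L[ℂ] H × H := T.prod (1 + z • T)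

theorem resolventGraphMap_eq_iff {z : ℂ} {T : H →L[ℂ] H} {f : H} {p : H × H} :
    resolventGraphMap z T f = p ↔ p.2 - z • p.1 = f ∧ T f = p.1 := by
  have happ : resolventGraphMap z T f = (T f, f + z • T f) := rfl
  rw [happ, Prod.ext_iff, and_comm]
  refine and_congr_left fun h => ?_
  rw [← h, sub_eq_iff_eq_add, eq_comm]

theorem mem_range_resolventGraphMap {z : ℂ} {T : H →L[ℂ] H} {p : H × H} :
    p ∈ (resolventGraphMap z T).range ↔ T (p.2 - z • p.1) = p.1 :=
  (exists_congr fun _ => resolventGraphMap_eq_iff).trans exists_eq_left'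

theorem isClosed_range_resolventGraphMap (z : ℂ) (T : H →L[ℂ] H) :
    IsClosed ((resolventGraphMap z T).range : Set (H × H)) := by
  have hset : ((resolventGraphMap z T).range : Set (H × H)) =
      {p | T (p.2 - z • p.1) = p.1} := Set.ext fun _ => mem_range_resolventGraphMap
  rw [hset]
  exact isClosed_eq (by fun_prop) (by fun_prop)

theorem isResolventAt_closure {z : ℂ} {T : H →L[ℂ] H} (hT : Function.Injective T)
    {D : Submodule ℂ H} (hD : D.topologicalClosure = ⊤) :
    IsResolventAt (D.map (resolventGraphMap z T : H →ₗ[ℂ] H × H)).toLinearPMap.closure z T := by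
  set Γ := resolventGraphMap z T
  have hle : D.map (Γ : H →ₗ[ℂ] H × H) ≤ Γ.range := LinearMap.map_le_range
  have hclosure : (D.map (Γ : H →ₗ[ℂ] H × H)).topologicalClosure = Γ.range := by
    refine le_antisymm (Submodule.topologicalClosure_minimal _ hle
      (isClosed_range_resolventGraphMap z T)) ?_
    rintro _ ⟨f, rfl⟩
    exact map_mem_closure Γ.continuous (hD ▸ Submodule.mem_top : f ∈ D.topologicalClosure)
      fun _ => Submodule.mem_map_of_mem
  have hfun : ∀ p ∈ Γ.range, p.1 = 0 → p.2 = 0 := by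
    rintro _ ⟨f, rfl⟩ (h : T f = 0)
    simp [Γ, resolventGraphMap, (map_eq_zero_iff T hT).1 h]
  have hgraph := Submodule.toLinearPMap_graph_eq _ fun p hp => hfun p (hle hp)
  have hclosable : (D.map (Γ : H →ₗ[ℂ] H × H)).toLinearPMap.IsClosable :=
    ⟨Γ.range.toLinearPMap, by rw [hgraph, hclosure, Submodule.toLinearPMap_graph_eq _ hfun]⟩
  rw [isResolventAt_iff_mem_graph]
  intro u w
  rw [← hclosable.graph_closure_eq_closure_graph, hgraph, hclosure, mem_range_resolventGraphMap]

end Closure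

section TensorResolvent

theorem tensorVec_sub_smul_left (z : ℂ) (u u' v : OneParticle) :
    tensorVec u v - z • tensorVec u' v = tensorVec (u - z • u') v := by
  ext1 s
  exact ((tensorL.map_sub₂ (u s.1) (z • u' s.1) (v s.2)).trans
    (congrArg (tensorFun (u s.1) (v s.2) - ·) (tensorFun_smul_left z (u' s.1) (v s.2)))).symm

theorem tensorVec_sub_smul_right (z : ℂ) (u v v' : OneParticle) :
    tensorVec u v - z • tensorVec u v' = tensorVec u (v - z • v') := by
  ext1 s
  exact (((tensorL (u s.1)).map_sub (v s.2) (z • v' s.2)).trans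
    (congrArg (tensorFun (u s.1) (v s.2) - ·) (tensorFun_smul_right z (u s.1) (v' s.2)))).symm

variable {A B : OneParticle →ₗ.[ℂ] OneParticle} {z : ℂ} {r : OneParticle →L[ℂ] OneParticle}
  {T : TwoParticle →L[ℂ] TwoParticle}

theorem isResolventAt_tensorOp (hT : Function.Injective T)
    (hleft : ∀ (u : A.domain) (v : B.domain), ∃ f g,
      tensorVec (A u) (B v) - z • tensorVec u.1 v.1 = tensorVec f g ∧
        T (tensorVec f g) = tensorVec u.1 v.1)
    (hright : ∀ f g, ∃ (u : A.domain) (v : B.domain),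
      tensorVec (A u) (B v) - z • tensorVec u.1 v.1 = tensorVec f g ∧
        T (tensorVec f g) = tensorVec u.1 v.1) :
    IsResolventAt (tensorOp A B) z T := by
  have hgraph : Submodule.span ℂ {p : TwoParticle × TwoParticle | ∃ (u : A.domain) (v : B.domain),
      p = (tensorVec u.1 v.1, tensorVec (A u) (B v))} =
      tensorSpan.map (resolventGraphMap z T : TwoParticle →ₗ[ℂ] TwoParticle × TwoParticle) := by
    rw [tensorSpan, Submodule.map_span]
    congr 1
    ext p
    constructor
    · rintro ⟨u, v, rfl⟩
      obtain ⟨f, g, h⟩ := hleft u v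
      exact ⟨_, ⟨f, g, rfl⟩, resolventGraphMap_eq_iff.2 h⟩
    · rintro ⟨_, ⟨f, g, rfl⟩, rfl⟩
      obtain ⟨u, v, h⟩ := hright f g
      exact ⟨u, v, resolventGraphMap_eq_iff.2 h⟩
  rw [tensorOp, algTensorOp, hgraph]
  exact isResolventAt_closure hT topologicalClosure_tensorSpan

theorem isResolventAt_tensorOp_left (hA : IsResolventAt A z r) (hT : Function.Injective T)
    (hTr : ∀ u v, T (tensorVec u v) = tensorVec (r u) v) :
    IsResolventAt (tensorOp A oneOp) z T := by
  refine isResolventAt_tensorOp hT (fun u v => ⟨A u - z • u.1, v, ?_, by rw [hTr, hA.2]⟩)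
    fun f g => ?_
  · exact tensorVec_sub_smul_left z (A u) u v
  · obtain ⟨u, hu, hAu⟩ := hA.1 f
    refine ⟨u, ⟨g, trivial⟩, ?_, by rw [hTr, hu]⟩
    rw [← hAu]
    exact tensorVec_sub_smul_left z (A u) u g

theorem isResolventAt_tensorOp_right (hA : IsResolventAt A z r) (hT : Function.Injective T)
    (hTr : ∀ u v, T (tensorVec u v) = tensorVec u (r v)) :
    IsResolventAt (tensorOp oneOp A) z T := by
  refine isResolventAt_tensorOp hT (fun u v => ⟨u, A v - z • v.1, ?_, by rw [hTr, hA.2]⟩)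
    fun f g => ?_
  · exact tensorVec_sub_smul_right z u (A v) v
  · obtain ⟨v, hv, hAv⟩ := hA.1 g
    refine ⟨⟨f, trivial⟩, v, ?_, by rw [hTr, hv]⟩
    rw [← hAv]
    exact tensorVec_sub_smul_right z f (A v) v

theorem diagMul_injective {ι E : Type*} [Fintype ι] [NormedAddCommGroup E] [InnerProductSpace ℝ E]
    [FiniteDimensional ℝ E] [MeasurableSpace E] [BorelSpace E] {m : ι → E →ᵇ ℂ}
    (hm : ∀ i ξ, m i ξ ≠ 0) : Function.Injective (diagMul m) := by
  rw [injective_iff_map_eq_zero]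
  intro f hf
  ext1 i
  refine (fourierL2 E).injective (Lp.ext ?_)
  have hi : fourierMul (m i) (f i) = 0 := congrArg (fun g : PiLp 2 _ => g i) hf
  have h := fourierL2_fourierMul (m i) (f i)
  rw [hi, map_zero] at h
  have h0 : fourierL2 E ((0 : PiLp 2 fun _ : ι => L2Space E) i) = 0 := map_zero _
  rw [h0]
  filter_upwards [h, Lp.coeFn_zero ℂ 2 (volume : Measure E)] with ξ h₁ h₂
  rw [h₂, Pi.zero_apply, zero_eq_mul] at h₁
  rw [h₂, Pi.zero_apply]
  exact h₁.resolve_left (hm i ξ)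

variable {a : Spin → R3 → ℂ} {m : Spin → R3 →ᵇ ℂ}

theorem IsFourierDiagonal.tensorOp_left (hA : IsFourierDiagonal a A)
    (hm : ∀ s ξ, m s ξ * (a s ξ - z) = 1) :
    IsFourierDiagonal (fun s ξ => a s.1 (fstR6 ξ)) (tensorOp A oneOp) := by
  refine (isFourierDiagonal_iff_isResolventAt
    (r := fun s : Spin × Spin => (m s.1).compContinuous fstR6) fun s ξ => hm _ _).2 ?_
  refine isResolventAt_tensorOp_left ((isFourierDiagonal_iff_isResolventAt hm).1 hA)
    (diagMul_injective fun s ξ => left_ne_zero_of_mul_eq_one (hm _ _)) fun u v => ?_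
  ext1 s
  exact fourierMul_fst_tensorFun _ _ _

theorem IsFourierDiagonal.tensorOp_right (hA : IsFourierDiagonal a A)
    (hm : ∀ s ξ, m s ξ * (a s ξ - z) = 1) :
    IsFourierDiagonal (fun s ξ => a s.2 (sndR6 ξ)) (tensorOp oneOp A) := by
  refine (isFourierDiagonal_iff_isResolventAt
    (r := fun s : Spin × Spin => (m s.2).compContinuous sndR6) fun s ξ => hm _ _).2 ?_
  refine isResolventAt_tensorOp_right ((isFourierDiagonal_iff_isResolventAt hm).1 hA)
    (diagMul_injective fun s ξ => left_ne_zero_of_mul_eq_one (hm _ _)) fun u v => ?_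
  ext1 s
  exact fourierMul_snd_tensorFun _ _ _

end TensorResolvent

section TwoParticle

variable {X : Type*} [TopologicalSpace X] {z : ℂ}

theorem ofReal_sub_ne_zero (hz : z.im ≠ 0) (t : ℝ) : (t : ℂ) - z ≠ 0 := fun h =>
  hz (by simpa using congrArg im h)

theorem norm_inv_ofReal_sub_le (hz : z.im ≠ 0) (t : ℝ) : ‖((t : ℂ) - z)⁻¹‖ ≤ |z.im|⁻¹ := by
  rw [norm_inv]
  refine inv_anti₀ (abs_pos.2 hz) ?_
  simpa using abs_im_le_norm ((t : ℂ) - z)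

/-- The bounded symbol `(a - z)⁻¹` of the resolvent at `z` of the multiplication operator by the
real symbol `a`. -/
def resolventSymbol (hz : z.im ≠ 0) (a : C(X, ℝ)) : X →ᵇ ℂ :=
  BoundedContinuousFunction.ofNormedAddCommGroup (fun x => ((a x : ℂ) - z)⁻¹)
    (Continuous.inv₀ (by fun_prop) fun x => ofReal_sub_ne_zero hz (a x)) |z.im|⁻¹
    fun x => norm_inv_ofReal_sub_le hz (a x)

theorem resolventSymbol_mul_sub (hz : z.im ≠ 0) (a : C(X, ℝ)) (x : X) :
    resolventSymbol hz a x * (a x - z) = 1 :=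
  inv_mul_cancel₀ (ofReal_sub_ne_zero hz (a x))

theorem norm_div_add_sub_le (hz : z.im ≠ 0) {a b c : ℝ} (hc : 0 ≤ c) (ha : -c ≤ a) (hb : -c ≤ b) :
    ‖(a : ℂ) * ((a + b : ℝ) - z)⁻¹‖ ≤ 1 + (c + ‖z‖) * |z.im|⁻¹ := by
  have hab : |a| ≤ |a + b| + c := by grind
  have hne : ‖((a + b : ℝ) : ℂ) - z‖ ≠ 0 := norm_ne_zero_iff.2 (ofReal_sub_ne_zero hz _)
  have htri : |a + b| ≤ ‖((a + b : ℝ) : ℂ) - z‖ + ‖z‖ := by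
    rw [← Real.norm_eq_abs, ← norm_real]
    exact norm_le_norm_sub_add _ _
  calc ‖(a : ℂ) * ((a + b : ℝ) - z)⁻¹‖
      = |a| * ‖((a + b : ℝ) - z : ℂ)⁻¹‖ := by rw [norm_mul, norm_real, Real.norm_eq_abs]
    _ ≤ (‖((a + b : ℝ) : ℂ) - z‖ + (c + ‖z‖)) * ‖((a + b : ℝ) - z : ℂ)⁻¹‖ := by
      gcongr
      linarith
    _ = 1 + (c + ‖z‖) * ‖((a + b : ℝ) - z : ℂ)⁻¹‖ := by
      rw [add_mul, norm_inv, mul_inv_cancel₀ hne]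
    _ ≤ 1 + (c + ‖z‖) * |z.im|⁻¹ := by
      gcongr
      exact norm_inv_ofReal_sub_le hz _

theorem neg_abs_le_rashbaSymbol (β : ℝ) (s : Spin) (ξ : R3) : -|β| ≤ rashbaSymbol β s ξ := by
  have hsign : |β * spinSign s| = |β| := by fin_cases s <;> simp [spinSign]
  have hkin : 0 ≤ (2 * Real.pi) ^ 2 * ‖ξ‖ ^ 2 := by positivity
  have := neg_abs_le (β * spinSign s)
  rw [rashbaSymbol_apply]
  linarith

/-- The symbol of the component `s` of the two-particle operator without spin-orbit coupling. -/
def twoParticleSymbol (β : ℝ) (s : Spin × Spin) : C(R6, ℝ) :=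
  (rashbaSymbol β s.1).comp fstR6 + (rashbaSymbol β s.2).comp sndR6

theorem isResolventAt_twoParticleOp (β : ℝ) (hz : z.im ≠ 0) :
    IsResolventAt (twoParticleOp 0 β) z
      (diagMul fun s => resolventSymbol hz (twoParticleSymbol β s)) := by
  have hm : ∀ s ξ, resolventSymbol hz (rashbaSymbol β s) ξ * (rashbaSymbol β s ξ - z) = 1 :=
    fun s ξ => resolventSymbol_mul_sub hz (rashbaSymbol β s) ξ
  let p : Spin × Spin → R6 →ᵇ ℂ := fun s =>
    BoundedContinuousFunction.ofNormedAddCommGroup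
      (fun ξ => (rashbaSymbol β s.1 (fstR6 ξ) : ℂ) * ((twoParticleSymbol β s ξ : ℂ) - z)⁻¹)
      ((by fun_prop : Continuous fun ξ => (rashbaSymbol β s.1 (fstR6 ξ) : ℂ)).mul
        (resolventSymbol hz (twoParticleSymbol β s)).continuous) _
      fun ξ => norm_div_add_sub_le hz (abs_nonneg β) (neg_abs_le_rashbaSymbol β s.1 _)
        (neg_abs_le_rashbaSymbol β s.2 _)
  have hp : ∀ s ξ, p s ξ * (rashbaSymbol β s.1 (fstR6 ξ) + rashbaSymbol β s.2 (sndR6 ξ) - z) =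
      rashbaSymbol β s.1 (fstR6 ξ) := fun s ξ => by
    rw [← ofReal_add]
    exact inv_mul_cancel_right₀ (ofReal_sub_ne_zero hz (twoParticleSymbol β s ξ)) _
  refine (isFourierDiagonal_iff_isResolventAt fun s ξ => ?_).1
    (((isFourierDiagonal_rashba β).tensorOp_left hm).add
      ((isFourierDiagonal_rashba β).tensorOp_right hm) hp)
  rw [Pi.add_apply, Pi.add_apply, ← ofReal_add]
  exact resolventSymbol_mul_sub hz (twoParticleSymbol β s) ξ

end TwoParticle

section FreeKernel

variable {E : Type*} [NormedAddCommGroup E] [InnerProductSpace ℝ E] [FiniteDimensional ℝ E]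
  [MeasurableSpace E] [BorelSpace E] {κ : ℂ}

/-- The integrand of the subordination formula for the kernel of `(-Δ + κ²)⁻¹`, up to a constant:
the heat kernel at time `s / κ`. With this complex rescaling of time the integral over `s` converges
absolutely for all `κ` with `Re κ > 0`, although `Re κ²` may be negative. -/
def heatKernel (κ : ℂ) (x : E) (s : ℝ) : ℂ :=
  (s ^ (-(Module.finrank ℝ E / 2 : ℝ)) : ℝ) * cexp (-κ * s) *
    cexp (-(κ / (4 * s)) * (‖x‖ : ℂ) ^ 2)

/-- The convolution kernel of `(-Δ + κ²)⁻¹`. -/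
def freeKernel (κ : ℂ) (x : E) : ℂ :=
  (κ * (4 * Real.pi / κ) ^ (Module.finrank ℝ E / 2 : ℂ))⁻¹ *
    ∫ s in Set.Ioi (0 : ℝ), heatKernel κ x s

theorem re_div_four_mul (s : ℝ) : (κ / (4 * s)).re = κ.re / (4 * s) := by
  rw [← ofReal_ofNat, ← ofReal_mul, div_ofReal_re]

omit [FiniteDimensional ℝ E] [MeasurableSpace E] [BorelSpace E] in
theorem norm_heatKernel {s : ℝ} (hs : 0 < s) (x : E) :
    ‖heatKernel κ x s‖ = s ^ (-(Module.finrank ℝ E / 2 : ℝ)) * Real.exp (-κ.re * s) *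
      Real.exp (-(κ.re / (4 * s)) * ‖x‖ ^ 2) := by
  have h₁ : (-κ * s).re = -κ.re * s := by simp
  have h₂ : (-(κ / (4 * s)) * (‖x‖ : ℂ) ^ 2).re = -(κ.re / (4 * s)) * ‖x‖ ^ 2 := by
    rw [← ofReal_pow, re_mul_ofReal, neg_re, re_div_four_mul]
  rw [heatKernel, norm_mul, norm_mul, norm_exp, norm_exp, h₁, h₂, norm_real,
    Real.norm_of_nonneg (Real.rpow_nonneg hs.le _)]

theorem integral_norm_heatKernel (hκ : 0 < κ.re) {s : ℝ} (hs : 0 < s) :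
    ∫ x : E, ‖heatKernel κ x s‖ =
      (4 * Real.pi / κ.re) ^ (Module.finrank ℝ E / 2 : ℝ) * Real.exp (-κ.re * s) := by
  have hdiv : Real.pi / (κ.re / (4 * s)) = s * (4 * Real.pi / κ.re) := by field_simp
  simp_rw [norm_heatKernel hs, integral_const_mul]
  rw [GaussianFourier.integral_rexp_neg_mul_sq_norm (by positivity), hdiv,
    Real.mul_rpow hs.le (by positivity), Real.rpow_neg hs.le]
  have := (Real.rpow_pos_of_pos hs (Module.finrank ℝ E / 2)).ne'
  field_simp

theorem integrable_heatKernel_left (hκ : 0 < κ.re) {s : ℝ} (hs : 0 < s) :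
    Integrable fun x : E => heatKernel κ x s := by
  have hb : 0 < (κ / (4 * s)).re := by
    rw [re_div_four_mul]
    positivity
  simpa [heatKernel] using (GaussianFourier.integrable_cexp_neg_mul_sq_norm_add hb 0
    (0 : E)).const_mul ((s ^ (-(Module.finrank ℝ E / 2 : ℝ)) : ℝ) * cexp (-κ * s))

theorem integrable_heatKernel (hκ : 0 < κ.re) :
    Integrable (fun p : E × ℝ => heatKernel κ p.1 p.2)
      (volume.prod (volume.restrict (Set.Ioi 0))) := by
  have hm : Measurable fun p : E × ℝ => heatKernel κ p.1 p.2 := by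
    unfold heatKernel
    fun_prop
  rw [integrable_prod_iff' hm.aestronglyMeasurable]
  refine ⟨?_, ((exp_neg_integrableOn_Ioi 0 hκ).const_mul
    ((4 * Real.pi / κ.re) ^ (Module.finrank ℝ E / 2 : ℝ))).congr ?_⟩ <;>
    filter_upwards [ae_restrict_mem measurableSet_Ioi] with s hs
  · exact integrable_heatKernel_left hκ hs
  · exact (integral_norm_heatKernel hκ hs).symm

theorem integrable_freeKernel (hκ : 0 < κ.re) : Integrable (freeKernel κ : E → ℂ) :=
  (integrable_heatKernel hκ).integral_prod_left.const_mul _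

theorem fourier_const_mul (c : ℂ) (f : E → ℂ) (ξ : E) :
    𝓕 (fun x => c * f x) ξ = c * 𝓕 f ξ :=
  congrFun (VectorFourier.fourierIntegral_const_smul Real.fourierChar volume (innerₗ E) f c) ξ

theorem fourier_setIntegral_swap {S : Set ℝ} {F : E → ℝ → ℂ}
    (hF : Integrable (fun p : E × ℝ => F p.1 p.2) (volume.prod (volume.restrict S))) (ξ : E) :
    𝓕 (fun x => ∫ s in S, F x s) ξ = ∫ s in S, 𝓕 (fun x => F x s) ξ := by
  simp_rw [Real.fourier_eq, Circle.smul_def, ← integral_smul]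
  refine integral_integral_swap (hF.mono ?_ (Eventually.of_forall fun p => ?_))
  · have hchar : Continuous fun p : E × ℝ => (Real.fourierChar (-⟪p.1, ξ⟫_ℝ) : ℂ) := by
      have := Real.continuous_fourierChar
      fun_prop
    exact hchar.aestronglyMeasurable.smul hF.aestronglyMeasurable
  · exact ((norm_smul _ _).trans (by rw [Circle.norm_coe, one_mul])).le

theorem ofReal_mul_cpow {r : ℝ} (hr : 0 < r) {w : ℂ} (hw : w ≠ 0) (c : ℂ) :
    (r * w) ^ c = (r : ℂ) ^ c * w ^ c := by
  have hr0 : (r : ℂ) ≠ 0 := ofReal_ne_zero.2 hr.ne'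
  rw [cpow_def_of_ne_zero (mul_ne_zero hr0 hw), cpow_def_of_ne_zero hr0, cpow_def_of_ne_zero hw,
    log_ofReal_mul hr hw, ofReal_log hr.le, add_mul, exp_add]

theorem four_mul_pi_div_ne_zero {w : ℂ} (hw : w ≠ 0) : 4 * Real.pi / w ≠ 0 :=
  div_ne_zero (mul_ne_zero (OfNat.ofNat_ne_zero 4) (ofReal_ne_zero.2 Real.pi_ne_zero)) hw

theorem fourier_heatKernel (hκ : 0 < κ.re) {s : ℝ} (hs : 0 < s) (ξ : E) :
    𝓕 (fun x : E => heatKernel κ x s) ξ = (4 * Real.pi / κ) ^ (Module.finrank ℝ E / 2 : ℂ) *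
      cexp (-(κ + (2 * Real.pi) ^ 2 * (‖ξ‖ : ℂ) ^ 2 / κ) * s) := by
  have hκ0 : κ ≠ 0 := ne_zero_of_re_pos hκ
  have hs0 : (s : ℂ) ≠ 0 := ofReal_ne_zero.2 hs.ne'
  have hb : 0 < (κ / (4 * s)).re := by
    rw [re_div_four_mul]
    positivity
  have hdiv : Real.pi / (κ / (4 * s)) = s * (4 * Real.pi / κ) := by field_simp
  have hpow : (s ^ (-(Module.finrank ℝ E / 2 : ℝ)) : ℝ) * (s : ℂ) ^ (Module.finrank ℝ E / 2 : ℂ) =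
      1 := by
    rw [ofReal_cpow hs.le, ← cpow_add _ _ hs0]
    simp
  have hexp : -κ * s + -Real.pi ^ 2 * (‖ξ‖ : ℂ) ^ 2 / (κ / (4 * s)) =
      -(κ + (2 * Real.pi) ^ 2 * (‖ξ‖ : ℂ) ^ 2 / κ) * s := by
    field_simp
    ring
  simp only [heatKernel]
  rw [fourier_const_mul, fourier_gaussian_innerProductSpace hb ξ, hdiv,
    ofReal_mul_cpow hs (four_mul_pi_div_ne_zero hκ0), ← hexp, exp_add]
  linear_combination cexp (-κ * s) * (4 * Real.pi / κ) ^ (Module.finrank ℝ E / 2 : ℂ) *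
    cexp (-Real.pi ^ 2 * (‖ξ‖ : ℂ) ^ 2 / (κ / (4 * s))) * hpow

theorem fourier_freeKernel (hκ : 0 < κ.re) (ξ : E) :
    𝓕 (freeKernel κ : E → ℂ) ξ = ((2 * Real.pi) ^ 2 * (‖ξ‖ : ℂ) ^ 2 + κ ^ 2)⁻¹ := by
  have hκ0 : κ ≠ 0 := ne_zero_of_re_pos hκ
  obtain ⟨a, ha_eq⟩ : ∃ a : ℂ, a = κ + (2 * Real.pi) ^ 2 * (‖ξ‖ : ℂ) ^ 2 / κ := ⟨_, rfl⟩
  have ha : 0 < a.re := by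
    have hinv : 0 ≤ (κ⁻¹).re := by
      rw [inv_re]
      exact div_nonneg hκ.le (normSq_nonneg _)
    have hre : a.re = κ.re + (2 * Real.pi) ^ 2 * ‖ξ‖ ^ 2 * (κ⁻¹).re := by
      rw [ha_eq, ← re_ofReal_mul, ← add_re]
      push_cast
      rfl
    rw [hre]
    positivity
  have hprod : (2 * Real.pi) ^ 2 * (‖ξ‖ : ℂ) ^ 2 + κ ^ 2 = κ * a := by
    rw [ha_eq]
    field_simp
    ring
  have hcpow : (4 * Real.pi / κ) ^ (Module.finrank ℝ E / 2 : ℂ) ≠ 0 :=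
    cpow_ne_zero_iff.2 (.inl (four_mul_pi_div_ne_zero hκ0))
  unfold freeKernel
  rw [fourier_const_mul, fourier_setIntegral_swap (integrable_heatKernel hκ),
    setIntegral_congr_fun measurableSet_Ioi fun s hs => fourier_heatKernel hκ hs ξ,
    ← ha_eq, integral_const_mul, integral_exp_mul_complex_Ioi (by rwa [neg_re, neg_lt_zero]),
    hprod, mul_inv, mul_inv]
  simp only [ofReal_zero, mul_zero, exp_zero, neg_div_neg_eq]
  field_simp

end FreeKernel

section Macdonald

theorem image_mul_exp_univ {c : ℝ} (hc : 0 < c) :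
    (fun t => c * Real.exp t) '' Set.univ = Set.Ioi 0 := by
  rw [Set.image_univ, ← Function.comp_def (c * ·), Set.range_comp, Real.range_exp,
    Set.image_mul_left_Ioi hc, mul_zero]

theorem injOn_mul_exp {c : ℝ} (hc : 0 < c) : Set.InjOn (fun t => c * Real.exp t) Set.univ :=
  ((mul_right_injective₀ hc.ne').comp Real.exp_injective).injOn

theorem hasDerivWithinAt_mul_exp (c : ℝ) (t : ℝ) :
    HasDerivWithinAt (fun t => c * Real.exp t) (c * Real.exp t) Set.univ t :=
  ((Real.hasDerivAt_exp t).const_mul c).hasDerivWithinAt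

theorem integral_Ioi_zero_eq_integral_mul_exp {c : ℝ} (hc : 0 < c) (f : ℝ → ℂ) :
    ∫ s in Set.Ioi 0, f s = ∫ t, ((c * Real.exp t : ℝ) : ℂ) * f (c * Real.exp t) := by
  rw [← image_mul_exp_univ hc, integral_image_eq_integral_abs_deriv_smul .univ
    (fun t _ => hasDerivWithinAt_mul_exp c t) (injOn_mul_exp hc), setIntegral_univ]
  refine integral_congr_ae (Eventually.of_forall fun t => ?_)
  simp only [abs_of_pos (mul_pos hc (Real.exp_pos t)), real_smul]

theorem integrableOn_Ioi_zero_iff_integrable_mul_exp {c : ℝ} (hc : 0 < c) (f : ℝ → ℂ) :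
    IntegrableOn f (Set.Ioi 0) ↔
      Integrable fun t => ((c * Real.exp t : ℝ) : ℂ) * f (c * Real.exp t) := by
  rw [← image_mul_exp_univ hc, integrableOn_image_iff_integrableOn_abs_deriv_smul .univ
    (fun t _ => hasDerivWithinAt_mul_exp c t) (injOn_mul_exp hc), integrableOn_univ]
  refine integrable_congr (Eventually.of_forall fun t => ?_)
  simp only [abs_of_pos (mul_pos hc (Real.exp_pos t)), real_smul]

theorem integral_exp_cosh_eq_two_mul_macdonald {ν w : ℂ}
    (h : Integrable fun t : ℝ => cexp (-w * cosh t) * cexp (-ν * t)) :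
    ∫ t : ℝ, cexp (-w * cosh t) * cexp (-ν * t) = 2 * macdonald ν w := by
  have hneg : ∫ t : ℝ in Set.Iic 0, cexp (-w * cosh t) * cexp (-ν * t) =
      ∫ t : ℝ in Set.Ioi 0, cexp (-w * cosh t) * cexp (ν * t) := by
    rw [← neg_zero, ← integral_comp_neg_Ioi]
    simp
  have hint : IntegrableOn (fun t : ℝ => cexp (-w * cosh t) * cexp (ν * t)) (Set.Ioi 0) := by
    simpa using h.comp_neg.integrableOn (s := Set.Ioi 0)
  rw [← intervalIntegral.integral_Iic_add_Ioi (b := 0) h.integrableOn h.integrableOn, hneg,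
    ← integral_add hint h.integrableOn, macdonald, ← integral_const_mul]
  refine integral_congr_ae (Eventually.of_forall fun t => ?_)
  simp only [cosh.eq_1 (ν * t), neg_mul]
  ring

theorem mul_rpow_mul_exp_eq_exp_cosh {r : ℝ} (hr : 0 < r) (ν : ℝ) (κ : ℂ) (t : ℝ) :
    ((r / 2 * Real.exp t : ℝ) : ℂ) *
      ((((r / 2 * Real.exp t) ^ (-(ν + 1)) : ℝ) : ℂ) * cexp (-κ * (r / 2 * Real.exp t : ℝ)) *
        cexp (-(κ / (4 * (r / 2 * Real.exp t : ℝ))) * (r : ℂ) ^ 2)) =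
      ((r / 2) ^ (-ν) : ℝ) * (cexp (-(r * κ) * cosh t) * cexp (-(ν : ℂ) * t)) := by
  have hr0 : (r : ℂ) ≠ 0 := ofReal_ne_zero.2 hr.ne'
  have ht : 0 < r / 2 * Real.exp t := by positivity
  have hpow : (r / 2 * Real.exp t) * (r / 2 * Real.exp t) ^ (-(ν + 1)) =
      (r / 2) ^ (-ν) * Real.exp (-ν * t) := by
    rw [neg_add, ← sub_eq_add_neg, Real.rpow_sub_one ht.ne', mul_div_cancel₀ _ ht.ne',
      Real.mul_rpow (by positivity) (by positivity), ← Real.exp_mul, mul_comm t]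
  have hcosh : -(r * κ) * cosh t = -κ * (r / 2 * Real.exp t : ℝ) +
      -(κ / (4 * (r / 2 * Real.exp t : ℝ))) * (r : ℂ) ^ 2 := by
    have := exp_ne_zero t
    push_cast
    rw [cosh, exp_neg]
    field_simp
    ring
  rw [hcosh, exp_add]
  have := congrArg ((↑) : ℝ → ℂ) hpow
  push_cast at this ⊢
  linear_combination cexp (-κ * (r / 2 * cexp t)) *
    cexp (-(κ / (4 * (r / 2 * cexp t))) * r ^ 2) * this

theorem integral_rpow_mul_exp_eq_macdonald {ν r : ℝ} (hr : 0 < r) (κ : ℂ)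
    (h : IntegrableOn (fun s : ℝ => ((s ^ (-(ν + 1)) : ℝ) : ℂ) * cexp (-κ * s) *
      cexp (-(κ / (4 * s)) * (r : ℂ) ^ 2)) (Set.Ioi 0)) :
    ∫ s : ℝ in Set.Ioi 0, ((s ^ (-(ν + 1)) : ℝ) : ℂ) * cexp (-κ * s) *
      cexp (-(κ / (4 * s)) * (r : ℂ) ^ 2) =
        ((r / 2) ^ (-ν) : ℝ) * (2 * macdonald ν (r * κ)) := by
  have hr2 : 0 < r / 2 := half_pos hr
  have hc : IsUnit (((r / 2) ^ (-ν) : ℝ) : ℂ) :=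
    (ofReal_ne_zero.2 (Real.rpow_pos_of_pos hr2 _).ne').isUnit
  have hsubst := Eventually.of_forall (f := ae volume) (mul_rpow_mul_exp_eq_exp_cosh hr ν κ)
  rw [integrableOn_Ioi_zero_iff_integrable_mul_exp hr2, integrable_congr hsubst,
    integrable_const_mul_iff hc] at h
  rw [integral_Ioi_zero_eq_integral_mul_exp hr2, integral_congr_ae hsubst, integral_const_mul,
    integral_exp_cosh_eq_two_mul_macdonald h]

variable {E : Type*} [NormedAddCommGroup E] [InnerProductSpace ℝ E] [FiniteDimensional ℝ E]
  [MeasurableSpace E] [BorelSpace E] {κ : ℂ}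

theorem freeKernel_eq_macdonald [Nontrivial E] (hκ : 0 < κ.re) :
    ∀ᵐ x : E, freeKernel κ x = (κ * (4 * Real.pi / κ) ^ (Module.finrank ℝ E / 2 : ℂ))⁻¹ *
      (((‖x‖ / 2) ^ (-(Module.finrank ℝ E / 2 - 1 : ℝ)) : ℝ) *
        (2 * macdonald (Module.finrank ℝ E / 2 - 1 : ℝ) (‖x‖ * κ))) := by
  filter_upwards [Measure.ae_ne volume (0 : E), (integrable_heatKernel hκ).prod_right_ae]
    with x hx hint
  have h := integral_rpow_mul_exp_eq_macdonald (ν := Module.finrank ℝ E / 2 - 1)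
    (norm_pos_iff.2 hx) κ
  rw [sub_add_cancel] at h
  rw [freeKernel, ← h hint]
  rfl

theorem freeKernel_eq_macdonald_of_finrank_eq_six (hE : Module.finrank ℝ E = 6)
    (hκ : 0 < κ.re) :
    ∀ᵐ x : E, freeKernel κ x =
      κ ^ 2 / (8 * (Real.pi : ℂ) ^ 3 * (‖x‖ : ℂ) ^ 2) * macdonald 2 (‖x‖ * κ) := by
  have : Nontrivial E := Module.nontrivial_of_finrank_pos (R := ℝ) (by rw [hE]; norm_num)
  have hκ0 : κ ≠ 0 := ne_zero_of_re_pos hκ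
  have hpi : (Real.pi : ℂ) ≠ 0 := ofReal_ne_zero.2 Real.pi_ne_zero
  have hpow : ((6 : ℕ) / 2 : ℂ) = (3 : ℕ) := by norm_num
  have hν : ((6 : ℕ) / 2 - 1 : ℝ) = (2 : ℕ) := by norm_num
  filter_upwards [freeKernel_eq_macdonald hκ, Measure.ae_ne volume (0 : E)] with x hx hx0
  have hr0 : (‖x‖ : ℂ) ≠ 0 := ofReal_ne_zero.2 (norm_ne_zero_iff.2 hx0)
  rw [hx, hE, hpow, hν, cpow_natCast, Real.rpow_neg (by positivity), Real.rpow_natCast]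
  push_cast
  field_simp
  ring

end Macdonald

/-! ### Convolution operators -/

section Convolution

variable {E : Type*} [NormedAddCommGroup E] [InnerProductSpace ℝ E] [FiniteDimensional ℝ E]
  [MeasurableSpace E] [BorelSpace E]

theorem ae_eq_of_fourier_ae_eq {h : E → ℂ} {g : L2Space E} (hh : Integrable h)
    (H : 𝓕 h =ᵐ[volume] fourierL2 E g) : h =ᵐ[volume] g := by
  refine ae_eq_of_forall_integral_schwartz_smul hh.locallyIntegrable
    (locallyIntegrable_coeFn_L2 g) fun φ => ?_
  obtain ⟨ψ, rfl⟩ : ∃ ψ : 𝓢(E, ℂ), 𝓕 ψ = φ := ⟨𝓕⁻ φ, FourierTransform.fourier_fourierInv_eq φ⟩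
  calc ∫ x, 𝓕 ψ x • h x = ∫ x, ψ x • 𝓕 h x := integral_fourier_schwartz_smul ψ hh
    _ = ∫ x, ψ x • fourierL2 E g x :=
      integral_congr_ae (H.mono fun x hx => congrArg (ψ x • ·) hx)
    _ = ∫ x, 𝓕 ψ x • g x := (integral_fourier_schwartz_smul_L2 ψ g).symm

theorem convolution_ae_eq_fourierMul {k : E → ℂ} {m : E →ᵇ ℂ} (hk : Integrable k)
    (hkm : 𝓕 k = m) {f : L2Space E} (hf : Integrable f) :
    k ⋆[ContinuousLinearMap.mul ℂ ℂ] f =ᵐ[volume] fourierMul m f := by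
  refine ae_eq_of_fourier_ae_eq (hk.integrable_convolution _ hf) ?_
  filter_upwards [fourierL2_fourierMul m f, coeFn_fourierL2_toLp hf (Lp.memLp f)] with ξ hm h
  rw [hm, Real.fourier_mul_convolution_eq hk hf, hkm, ← h, Lp.toLp_coeFn]

theorem memLp_indicator_closedBall (f : L2Space E) (r : ℝ) :
    MemLp ((Metric.closedBall (0 : E) r).indicator f) 2 :=
  (Lp.memLp f).indicator Metric.isClosed_closedBall.measurableSet

/-- The restriction of `f` to the closed ball of radius `r`, extended by zero. -/
def truncBall (f : L2Space E) (r : ℝ) : L2Space E :=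
  (memLp_indicator_closedBall f r).toLp _

theorem coeFn_truncBall (f : L2Space E) (r : ℝ) :
    truncBall f r =ᵐ[volume] (Metric.closedBall (0 : E) r).indicator f :=
  (memLp_indicator_closedBall f r).coeFn_toLp

theorem integrable_truncBall (f : L2Space E) (r : ℝ) : Integrable (truncBall f r) := by
  refine ((integrable_indicator_iff Metric.isClosed_closedBall.measurableSet).2 ?_).congr
    (coeFn_truncBall f r).symm
  exact (locallyIntegrable_coeFn_L2 f).integrableOn_isCompact (isCompact_closedBall 0 r)

theorem tendsto_truncBall (f : L2Space E) : Tendsto (truncBall f) atTop (𝓝 f) := by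
  have hball (r : ℝ) : MeasurableSet (Metric.closedBall (0 : E) r) :=
    Metric.isClosed_closedBall.measurableSet
  have hnorm : ∀ r, eLpNorm ((Metric.closedBall (0 : E) r).indicator f - (f : E → ℂ)) 2 volume =
      ENNReal.ofReal ((∫ x in (Metric.closedBall (0 : E) r)ᶜ, ‖f x‖ ^ (2 : ℝ)) ^ (2 : ℝ)⁻¹) :=
    fun r => by
      rw [← eLpNorm_neg, neg_sub, ← Set.indicator_compl,
        eLpNorm_indicator_eq_eLpNorm_restrict (hball r).compl,
        ((Lp.memLp f).restrict _).eLpNorm_eq_integral_rpow_norm two_ne_zero ENNReal.ofNat_ne_top,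
        ENNReal.toReal_ofNat]
  have hinter : ⋂ r : ℝ, (Metric.closedBall (0 : E) r)ᶜ = ∅ := by
    rw [← Set.compl_iUnion, Set.compl_empty_iff, Set.eq_univ_iff_forall]
    exact fun x => Set.mem_iUnion.2 ⟨‖x‖, by simp⟩
  have htail := tendsto_setIntegral_of_antitone (fun r => (hball r).compl)
    (fun r s hrs => Set.compl_subset_compl.2 (Metric.closedBall_subset_closedBall hrs))
    ⟨0, ((Lp.memLp f).integrable_norm_rpow two_ne_zero ENNReal.ofNat_ne_top).integrableOn⟩
  rw [hinter, setIntegral_empty, ENNReal.toReal_ofNat] at htail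
  have h := (Lp.tendsto_Lp_iff_tendsto_eLpNorm'' (fi := atTop) _ (memLp_indicator_closedBall f) _
    (Lp.memLp f)).2
  rw [Lp.toLp_coeFn] at h
  refine h ?_
  simpa [hnorm] using ENNReal.tendsto_ofReal (htail.rpow_const (p := (2 : ℝ)⁻¹) (by simp))

theorem mul_truncBall_ae_eq (k : E → ℂ) (f : L2Space E) (r : ℝ) :
    (fun y => k y * truncBall f r y) =ᵐ[volume]
      (Metric.closedBall 0 r).indicator fun y => k y * f y := by
  filter_upwards [coeFn_truncBall f r] with y hy
  rw [hy, Set.indicator_mul_right]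

theorem convolution_truncBall (k : E → ℂ) (f : L2Space E) (r : ℝ) (x : E) :
    (k ⋆[ContinuousLinearMap.mul ℂ ℂ] truncBall f r) x =
      ∫ y in Metric.closedBall 0 r, k (x - y) * f y := by
  rw [convolution_mul_swap, ← integral_indicator Metric.isClosed_closedBall.measurableSet]
  exact integral_congr_ae (mul_truncBall_ae_eq (fun y => k (x - y)) f r)

theorem tendsto_eLpNorm_setIntegral_closedBall_convolution {k : E → ℂ} {m : E →ᵇ ℂ}
    (hk : Integrable k) (hkm : 𝓕 k = m) (f : L2Space E) :
    Tendsto (fun r : ℝ => eLpNorm (fun x => (∫ y in Metric.closedBall (0 : E) r, k (x - y) * f y) -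
      fourierMul m f x) 2 volume) atTop (𝓝 0) := by
  have h := ((fourierMul m).continuous.tendsto f).comp (tendsto_truncBall f)
  refine ((Lp.tendsto_Lp_iff_tendsto_eLpNorm' _ _).1 h).congr fun r => eLpNorm_congr_ae ?_
  filter_upwards [convolution_ae_eq_fourierMul hk hkm (integrable_truncBall f r)] with x hx
  rw [Pi.sub_apply, Function.comp_apply, ← hx, convolution_truncBall]

theorem integrableOn_closedBall_convolution {k : E → ℂ} (hk : Integrable k) (f : L2Space E)
    (r : ℝ) : ∀ᵐ x, IntegrableOn (fun y => k (x - y) * f y) (Metric.closedBall 0 r) := by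
  filter_upwards [(integrable_truncBall f r).ae_convolution_exists (ContinuousLinearMap.mul ℂ ℂ) hk]
    with x hx
  rw [← integrable_indicator_iff Metric.isClosed_closedBall.measurableSet]
  refine hx.congr (.trans ?_ (mul_truncBall_ae_eq (fun y => k (x - y)) f r))
  exact Eventually.of_forall fun y => mul_comm _ _

theorem ae_eq_of_forall_convolution_ae_eq {k l : E → ℂ} (hk : LocallyIntegrable k)
    (hl : LocallyIntegrable l)
    (h : ∀ φ : E → ℂ, Continuous φ → HasCompactSupport φ →
      k ⋆[ContinuousLinearMap.mul ℂ ℂ] φ =ᵐ[volume] l ⋆[ContinuousLinearMap.mul ℂ ℂ] φ) :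
    k =ᵐ[volume] l := by
  refine ae_eq_of_integral_contDiff_smul_eq hk hl fun φ hφ hφc => ?_
  set ψ : E → ℂ := fun y => φ (-y)
  have hψ : Continuous ψ := by
    have := hφ.continuous
    fun_prop
  have hψc : HasCompactSupport ψ :=
    (hφc.comp_homeomorph (Homeomorph.neg E)).comp_left (g := ((↑) : ℝ → ℂ)) ofReal_zero
  have hzero : ∀ j : E → ℂ, (j ⋆[ContinuousLinearMap.mul ℂ ℂ] ψ) 0 = ∫ x, φ x • j x := fun j => by
    rw [convolution_mul_swap, ← integral_neg_eq_self]
    refine integral_congr_ae (Eventually.of_forall fun y => ?_)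
    simp [ψ, mul_comm]
  have heq := (Continuous.ae_eq_iff_eq volume (hψc.continuous_convolution_right _ hk hψ)
    (hψc.continuous_convolution_right _ hl hψ)).1 (h ψ hψ hψc)
  rw [← hzero, heq, hzero]

theorem convolution_ae_eq_of_tendsto_setIntegral_closedBall {k φ : E → ℂ}
    (hk : LocallyIntegrable k) (hφ : Continuous φ) (hφc : HasCompactSupport φ) {f g : L2Space E}
    (hf : f =ᵐ[volume] φ)
    (h : Tendsto (fun r : ℝ => eLpNorm
      (fun x => (∫ y in Metric.closedBall (0 : E) r, k (x - y) * f y) - g x) 2 volume)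
      atTop (𝓝 0)) :
    k ⋆[ContinuousLinearMap.mul ℂ ℂ] φ =ᵐ[volume] g := by
  obtain ⟨r₀, hr₀⟩ := hφc.isCompact.isBounded.subset_closedBall (0 : E)
  have htrunc : ∀ r, r₀ ≤ r → ∀ x, ∫ y in Metric.closedBall (0 : E) r, k (x - y) * f y =
      (k ⋆[ContinuousLinearMap.mul ℂ ℂ] φ) x := fun r hr x => by
    have hsupp : ∀ y ∉ Metric.closedBall (0 : E) r, k (x - y) * φ y = 0 := fun y hy => by
      rw [image_eq_zero_of_notMem_tsupport fun hy' =>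
        hy (Metric.closedBall_subset_closedBall hr (hr₀ hy')), mul_zero]
    rw [convolution_mul_swap, ← setIntegral_eq_integral_of_forall_compl_eq_zero hsupp]
    exact setIntegral_congr_ae Metric.isClosed_closedBall.measurableSet
      (hf.mono fun y hy _ => by rw [hy])
  have hzero : eLpNorm (k ⋆[ContinuousLinearMap.mul ℂ ℂ] φ - (g : E → ℂ)) 2 volume = 0 := by
    refine tendsto_nhds_unique (tendsto_const_nhds (f := atTop (α := ℝ))) (h.congr' ?_)
    filter_upwards [eventually_ge_atTop r₀] with r hr
    simp_rw [htrunc r hr]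
    rfl
  have hmeas := (hφc.continuous_convolution_right (ContinuousLinearMap.mul ℂ ℂ) hk
    hφ).aestronglyMeasurable (μ := volume)
  exact (sub_ae_eq_zero _ _).1 ((eLpNorm_eq_zero_iff (hmeas.sub (Lp.aestronglyMeasurable g))
    two_ne_zero).1 hzero)

end Convolution

theorem isLimConv_fourierMul {k : R6 → ℂ} {m : R6 →ᵇ ℂ} (hk : Integrable k) (hkm : 𝓕 k = m)
    (f : L2R6) : IsLimConv k f (fourierMul m f) :=
  ⟨integrableOn_closedBall_convolution hk f,
    tendsto_eLpNorm_setIntegral_closedBall_convolution hk hkm f⟩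

theorem ae_eq_of_forall_isLimConv {k l : R6 → ℂ} (hk : LocallyIntegrable k)
    (hl : LocallyIntegrable l) (h : ∀ f : L2R6, ∃ g, IsLimConv k f g ∧ IsLimConv l f g) :
    k =ᵐ[volume] l := by
  refine ae_eq_of_forall_convolution_ae_eq hk hl fun φ hφ hφc => ?_
  have hL : MemLp φ 2 (volume : Measure R6) := hφ.memLp_of_hasCompactSupport hφc
  obtain ⟨g, hkg, hlg⟩ := h (hL.toLp φ)
  exact (convolution_ae_eq_of_tendsto_setIntegral_closedBall hk hφ hφc hL.coeFn_toLp hkg.2).trans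
    (convolution_ae_eq_of_tendsto_setIntegral_closedBall hl hφ hφc hL.coeFn_toLp hlg.2).symm

/-! ### The Green function -/

theorem csqrt_sq (w : ℂ) : csqrt w ^ 2 = w := by
  rw [csqrt, ← cpow_nat_mul]
  norm_num

theorem csqrt_re_pos {w : ℂ} (hw : w.im ≠ 0) : 0 < (csqrt w).re := by
  have hw₀ : w ≠ 0 := by
    rintro rfl
    exact hw zero_im
  have him : (log w * (1 / 2)).im = arg w / 2 := by
    simp [mul_im, log_im, div_eq_mul_inv]
  have harg : arg w < Real.pi :=
    (arg_le_pi w).lt_of_ne fun h => hw (arg_eq_pi_iff.1 h).2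
  have hcos : 0 < Real.cos (arg w / 2) :=
    Real.cos_pos_of_mem_Ioo ⟨by linarith [neg_pi_lt_arg w], by linarith⟩
  rw [csqrt, cpow_def_of_ne_zero hw₀, exp_re, him]
  positivity

theorem finrank_R6 : Module.finrank ℝ R6 = 6 := by
  rw [(WithLp.linearEquiv 2 ℝ (R3 × R3)).finrank_eq, Module.finrank_prod,
    finrank_euclideanSpace_fin]

/-- The spectral parameter `z - 2βs` that the resolvent of the free Laplacian takes in the channel
`σ = (S, s)`. -/
def channelParam (β : ℝ) (z : ℂ) (σ : Coupled) : ℂ := z - 2 * β * σ.s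

/-- The symbol of the two-particle operator without spin-orbit coupling in the channel `σ`. -/
def channelSymbol (β : ℝ) (σ : Coupled) : C(R6, ℝ) where
  toFun ξ := (2 * Real.pi) ^ 2 * ‖ξ‖ ^ 2 + 2 * β * σ.s

theorem channelSymbol_sub (β : ℝ) (z : ℂ) (σ : Coupled) (ξ : R6) :
    channelSymbol β σ ξ - z = (2 * Real.pi) ^ 2 * (‖ξ‖ : ℂ) ^ 2 - channelParam β z σ := by
  simp only [channelSymbol, channelParam, ContinuousMap.coe_mk]
  push_cast
  ring

theorem csqrt_channelParam_re_pos (β : ℝ) {z : ℂ} (hz : z.im ≠ 0) (σ : Coupled) :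
    0 < (csqrt (-channelParam β z σ)).re := by
  refine csqrt_re_pos ?_
  have him : (channelParam β z σ).im = z.im := by simp [channelParam]
  rwa [neg_im, him, neg_ne_zero]

theorem spinSign_add_of_clebschGordan_ne_zero {s : Spin × Spin} {σ : Coupled}
    (h : clebschGordan s.1 s.2 σ ≠ 0) : spinSign s.1 + spinSign s.2 = 2 * σ.s := by
  obtain ⟨s₁, s₂⟩ := s
  revert h
  cases σ <;> fin_cases s₁ <;> fin_cases s₂ <;>
    norm_num [clebschGordan, spinSign, Coupled.s]

theorem twoParticleSymbol_eq_channelSymbol (β : ℝ) {s : Spin × Spin} {σ : Coupled}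
    (h : clebschGordan s.1 s.2 σ ≠ 0) : twoParticleSymbol β s = channelSymbol β σ := by
  ext ξ
  have hnorm : ‖ξ‖ ^ 2 = ‖fstR6 ξ‖ ^ 2 + ‖sndR6 ξ‖ ^ 2 := WithLp.prod_norm_sq_eq_of_L2 ξ
  simp only [twoParticleSymbol, channelSymbol, ContinuousMap.add_apply, ContinuousMap.comp_apply,
    rashbaSymbol_apply, ContinuousMap.coe_mk, hnorm]
  linear_combination β * spinSign_add_of_clebschGordan_ne_zero h

/-- The component of the two-particle resolvent at `z` in the channel `σ`. -/
def channelResolvent (β : ℝ) {z : ℂ} (hz : z.im ≠ 0) (σ : Coupled) : L2R6 →L[ℂ] L2R6 :=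
  fourierMul (resolventSymbol hz (channelSymbol β σ))

theorem comCoupledMap_apply (w : TwoParticle) (σ : Coupled) :
    comCoupledMap w σ = ∑ s₁, ∑ s₂, clebschGordan s₁ s₂ σ • comUnitary (w (s₁, s₂)) := by
  change (∑ s₁, ∑ s₂, clebschGordan s₁ s₂ σ •
    (comUnitary ∘L PiLp.proj 2 (fun _ : Spin × Spin => L2R6) (s₁, s₂))) w = _
  simp only [sum_apply, smul_apply, ContinuousLinearMap.comp_apply, PiLp.proj_apply]

/-- The two-particle vector with spin state `|σ⟩` and wave function `f`. -/
def coupledVec (f : L2R6) (σ : Coupled) : TwoParticle :=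
  WithLp.toLp 2 fun s => clebschGordan s.1 s.2 σ • f

theorem conj_clebschGordan (s₁ s₂ : Spin) (σ : Coupled) :
    (starRingEnd ℂ) (clebschGordan s₁ s₂ σ) = clebschGordan s₁ s₂ σ := by
  cases σ <;> unfold clebschGordan <;> split_ifs <;> simp

theorem sum_clebschGordan_mul (σ' σ : Coupled) :
    ∑ s₁, ∑ s₂, clebschGordan s₁ s₂ σ' * clebschGordan s₁ s₂ σ = kron σ' σ := by
  have hsqrt : ((√2 : ℝ) : ℂ)⁻¹ * ((√2 : ℝ) : ℂ)⁻¹ = 1 / 2 := by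
    rw [← mul_inv, ← ofReal_mul, Real.mul_self_sqrt (by norm_num)]
    norm_num
  cases σ' <;> cases σ <;> simp [Fin.sum_univ_two, clebschGordan, kron, hsqrt] <;> norm_num

theorem kron_smul_eq_single (f : L2R6) (σ σ' : Coupled) :
    kron σ' σ • f = (Pi.single σ f : Coupled → L2R6) σ' := by
  rw [kron, ite_smul, one_smul, zero_smul, Pi.single_apply]

theorem comCoupledMap_coupledVec (f : L2R6) (σ : Coupled) :
    comCoupledMap (coupledVec f σ) = tensorKet (comUnitary f) σ := by
  ext1 σ'
  calc comCoupledMap (coupledVec f σ) σ'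
      = ∑ s₁, ∑ s₂, clebschGordan s₁ s₂ σ' • comUnitary (clebschGordan s₁ s₂ σ • f) :=
        comCoupledMap_apply _ _
    _ = kron σ' σ • comUnitary f := by
        simp_rw [map_smul, smul_smul, ← Finset.sum_smul, sum_clebschGordan_mul]
    _ = tensorKet (comUnitary f) σ σ' := kron_smul_eq_single _ _ _

theorem inner_comUnitary (f g : L2R6) : ⟪comUnitary f, comUnitary g⟫_ℂ = ⟪f, g⟫_ℂ :=
  (Lp.compMeasurePreservingₗᵢ ℂ comMap measurePreserving_comMap).inner_map_map f g

theorem comUnitary_injective : Function.Injective comUnitary := fun _ _ h =>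
  (Lp.compMeasurePreservingₗᵢ ℂ comMap measurePreserving_comMap).injective h

theorem inner_tensorKet (f : L2R6) (σ : Coupled) (v : CoupledSpace) :
    ⟪tensorKet f σ, v⟫_ℂ = ⟪f, v σ⟫_ℂ := by
  rw [PiLp.inner_apply, Finset.sum_eq_single σ (fun τ _ hτ => ?_) (by simp)]
  · rw [tensorKet, PiLp.toLp_apply, Pi.single_eq_same]
  · rw [tensorKet, PiLp.toLp_apply, Pi.single_eq_of_ne hτ, inner_zero_left]

theorem adjoint_comCoupledMap_tensorKet (f : L2R6) (σ : Coupled) :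
    ContinuousLinearMap.adjoint comCoupledMap (tensorKet (comUnitary f) σ) = coupledVec f σ := by
  refine ext_inner_right ℂ fun w => ?_
  rw [ContinuousLinearMap.adjoint_inner_left, inner_tensorKet, comCoupledMap_apply,
    PiLp.inner_apply, Fintype.sum_prod_type]
  simp only [coupledVec, inner_sum, inner_smul_left, inner_smul_right, inner_comUnitary,
    conj_clebschGordan]

theorem diagMul_coupledVec (β : ℝ) {z : ℂ} (hz : z.im ≠ 0) (f : L2R6) (σ : Coupled) :
    diagMul (fun s => resolventSymbol hz (twoParticleSymbol β s)) (coupledVec f σ) =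
      coupledVec (channelResolvent β hz σ f) σ := by
  ext1 s
  change fourierMul (resolventSymbol hz (twoParticleSymbol β s)) (clebschGordan s.1 s.2 σ • f) =
    clebschGordan s.1 s.2 σ • channelResolvent β hz σ f
  rw [map_smul]
  by_cases h : clebschGordan s.1 s.2 σ = 0
  · rw [h, zero_smul, zero_smul]
  · rw [twoParticleSymbol_eq_channelSymbol β h, channelResolvent]

theorem sum_tensorKet (g : Coupled → L2R6) : ∑ σ, tensorKet (g σ) σ = WithLp.toLp 2 g := by
  simp only [tensorKet]
  rw [← WithLp.toLp_sum, Finset.univ_sum_single]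

theorem comConj_resolvent_tensorKet (β : ℝ) {z : ℂ} (hz : z.im ≠ 0) (f : L2R6) (σ : Coupled) :
    comConj (diagMul fun s => resolventSymbol hz (twoParticleSymbol β s))
        (tensorKet (comUnitary f) σ) =
      ∑ σ', tensorKet (comUnitary (kron σ' σ • channelResolvent β hz σ f)) σ' := by
  rw [comConj, ContinuousLinearMap.comp_apply, ContinuousLinearMap.comp_apply,
    adjoint_comCoupledMap_tensorKet, diagMul_coupledVec, comCoupledMap_coupledVec, sum_tensorKet]
  ext1 σ'
  exact (kron_smul_eq_single _ _ _).symm.trans (comUnitary.map_smul _ _).symm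

/-- The Green function of the two-particle operator without spin-orbit coupling: the kernel of the
free resolvent at the spectral parameter of each channel. -/
def greenKernel (β : ℝ) (z : ℂ) (σ' σ : Coupled) (Q : R6) : ℂ :=
  kron σ' σ * freeKernel (csqrt (-channelParam β z σ)) Q

theorem integrable_greenKernel (β : ℝ) {z : ℂ} (hz : z.im ≠ 0) (σ' σ : Coupled) :
    Integrable (greenKernel β z σ' σ) :=
  (integrable_freeKernel (csqrt_channelParam_re_pos β hz σ)).const_mul _

theorem fourier_greenKernel (β : ℝ) {z : ℂ} (hz : z.im ≠ 0) (σ' σ : Coupled) :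
    𝓕 (greenKernel β z σ' σ) =
      (kron σ' σ • resolventSymbol hz (channelSymbol β σ) : R6 →ᵇ ℂ) := by
  ext ξ
  change 𝓕 (fun Q : R6 => kron σ' σ * freeKernel (csqrt (-channelParam β z σ)) Q) ξ =
    kron σ' σ * (channelSymbol β σ ξ - z : ℂ)⁻¹
  rw [fourier_const_mul, fourier_freeKernel (csqrt_channelParam_re_pos β hz σ), csqrt_sq,
    channelSymbol_sub, sub_eq_add_neg]

theorem isLimConv_greenKernel (β : ℝ) {z : ℂ} (hz : z.im ≠ 0) (σ' σ : Coupled) (f : L2R6) :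
    IsLimConv (greenKernel β z σ' σ) f (kron σ' σ • channelResolvent β hz σ f) := by
  have h := isLimConv_fourierMul (integrable_greenKernel β hz σ' σ)
    (fourier_greenKernel β hz σ' σ) f
  rwa [map_smul] at h

theorem isGreenFunction_greenKernel (β : ℝ) {z : ℂ} (hz : z.im ≠ 0) :
    IsGreenFunction 0 β z (greenKernel β z) :=
  ⟨fun σ' σ => (integrable_greenKernel β hz σ' σ).locallyIntegrable, _,
    isResolventAt_twoParticleOp β hz, fun f σ =>
      ⟨_, fun σ' => isLimConv_greenKernel β hz σ' σ f, comConj_resolvent_tensorKet β hz f σ⟩⟩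

theorem IsGreenFunction.ae_eq_greenKernel {β : ℝ} {z : ℂ} (hz : z.im ≠ 0)
    {G : Coupled → Coupled → R6 → ℂ} (hG : IsGreenFunction 0 β z G) (σ' σ : Coupled) :
    G σ' σ =ᵐ[volume] greenKernel β z σ' σ := by
  obtain ⟨hloc, R, hR, hconv⟩ := hG
  obtain rfl := hR.unique (isResolventAt_twoParticleOp β hz)
  refine ae_eq_of_forall_isLimConv (hloc σ' σ)
    (integrable_greenKernel β hz σ' σ).locallyIntegrable fun f => ?_
  obtain ⟨g, hg, hsum⟩ := hconv f σ
  rw [comConj_resolvent_tensorKet, sum_tensorKet, sum_tensorKet] at hsum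
  have hgσ' : g σ' = kron σ' σ • channelResolvent β hz σ f :=
    comUnitary_injective (congrFun (WithLp.toLp_injective 2 hsum) σ').symm
  exact ⟨g σ', hg σ', hgσ' ▸ isLimConv_greenKernel β hz σ' σ f⟩

theorem greenKernel_eq_macdonald (β : ℝ) {z : ℂ} (hz : z.im ≠ 0) (σ' σ : Coupled) :
    ∀ᵐ Q : R6, greenKernel β z σ' σ Q =
      -(kron σ' σ / (8 * (Real.pi : ℂ) ^ 3 * (‖Q‖ : ℂ) ^ 2)) *
        (channelParam β z σ * macdonald 2 (‖Q‖ * csqrt (-channelParam β z σ))) := by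
  filter_upwards [freeKernel_eq_macdonald_of_finrank_eq_six finrank_R6
    (csqrt_channelParam_re_pos β hz σ)] with Q hQ
  rw [greenKernel, hQ, csqrt_sq]
  ring

theorem IsGreenFunction.ae_eq_macdonald {β : ℝ} {z : ℂ} (hz : z.im ≠ 0)
    {G : Coupled → Coupled → R6 → ℂ} (hG : IsGreenFunction 0 β z G) (σ' σ : Coupled) :
    ∀ᵐ Q : R6, G σ' σ Q = -(kron σ' σ / (8 * (Real.pi : ℂ) ^ 3 * (‖Q‖ : ℂ) ^ 2)) *
      (channelParam β z σ * macdonald 2 (‖Q‖ * csqrt (-channelParam β z σ))) :=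
  (hG.ae_eq_greenKernel hz σ' σ).trans (greenKernel_eq_macdonald β hz σ' σ)

theorem channelParam_zero (z : ℂ) (σ : Coupled) : channelParam 0 z σ = z := by
  simp [channelParam]

theorem channelParam_mul_macdonald (β : ℝ) (z : ℂ) (σ : Coupled) (r : ℝ) :
    channelParam β z σ * macdonald 2 (r * csqrt (-channelParam β z σ)) =
      kron σ.s 0 * z * macdonald 2 (r * csqrt (-z)) + kron σ.S 1 *
        (kron σ.s 1 * (z - 2 * β) * macdonald 2 (r * csqrt (2 * β - z)) +
          kron σ.s (-1) * (z + 2 * β) * macdonald 2 (r * csqrt (-(2 * β) - z))) := by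
  have hplus : 2 * β - z = -(z - 2 * β) := by ring
  have hminus : -(2 * β) - z = -(z + 2 * β) := by ring
  rw [hplus, hminus]
  cases σ <;> simp [channelParam, kron, Coupled.s, Coupled.S]

end

end Rashba

theorem proposition4p1_general (β : ℝ) (z : ℂ) (hz : z.im ≠ 0) :
    (∃ G : Coupled → Coupled → R6 → ℂ, IsGreenFunction 0 β z G) ∧
    ∀ G : Coupled → Coupled → R6 → ℂ, IsGreenFunction 0 β z G →
      (∀ σ' σ : Coupled, ∀ᵐ Q : R6,
        G σ' σ Q = -(kron σ' σ / (8 * (Real.pi : ℂ) ^ 3 * (‖Q‖ : ℂ) ^ 2)) *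
          (kron σ.s 0 * z * macdonald 2 (‖Q‖ * csqrt (-z))
            + kron σ.S 1 *
              (kron σ.s 1 * (z - 2 * β) * macdonald 2 (‖Q‖ * csqrt (2 * β - z))
                + kron σ.s (-1) * (z + 2 * β) * macdonald 2 (‖Q‖ * csqrt (-(2 * β) - z))))) ∧
      (β = 0 → ∀ σ' σ : Coupled, ∀ᵐ Q : R6,
        G σ' σ Q = -kron σ' σ *
          (z * macdonald 2 (‖Q‖ * csqrt (-z)) / (8 * (Real.pi : ℂ) ^ 3 * (‖Q‖ : ℂ) ^ 2))) := by
  refine ⟨⟨greenKernel β z, isGreenFunction_greenKernel β hz⟩, fun G hG => ⟨fun σ' σ => ?_, ?_⟩⟩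
  · filter_upwards [hG.ae_eq_macdonald hz σ' σ] with Q hQ
    rw [hQ, channelParam_mul_macdonald]
  · rintro rfl σ' σ
    filter_upwards [hG.ae_eq_macdonald hz σ' σ] with Q hQ
    rw [hQ, channelParam_zero]
    ring

theorem proposition4p1 (β : ℝ) (hβ : 0 ≤ β) (z : ℂ) (hz : z.im ≠ 0) :
    (∃ G : Coupled → Coupled → R6 → ℂ, IsGreenFunction 0 β z G) ∧
    ∀ G : Coupled → Coupled → R6 → ℂ, IsGreenFunction 0 β z G →
      (∀ σ' σ : Coupled, ∀ᵐ Q : R6,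
        G σ' σ Q = -(kron σ' σ / (8 * (Real.pi : ℂ) ^ 3 * (‖Q‖ : ℂ) ^ 2)) *
          (kron σ.s 0 * z * macdonald 2 (‖Q‖ * csqrt (-z))
            + kron σ.S 1 *
              (kron σ.s 1 * (z - 2 * β) * macdonald 2 (‖Q‖ * csqrt (2 * β - z))
                + kron σ.s (-1) * (z + 2 * β) * macdonald 2 (‖Q‖ * csqrt (-(2 * β) - z))))) ∧
      (β = 0 → ∀ σ' σ : Coupled, ∀ᵐ Q : R6,
        G σ' σ Q = -kron σ' σ *
          (z * macdonald 2 (‖Q‖ * csqrt (-z)) / (8 * (Real.pi : ℂ) ^ 3 * (‖Q‖ : ℂ) ^ 2))) := by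
  exact proposition4p1_general β z hz
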